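/- Let $0\le t<n$ be integers. **Model.** Processes are deterministic, asynchronous state machines with arbitrary local state sets, and every operation on a shared object is one atomic step. An execution is determined by the inputs of the $n$ processes and by an infinite schedule that names the process taking each step; a process that has decided only takes idle steps, and a process crashes if it is scheduled only finitely often. An execution is $t$-resilient if at most $t$ processes crash in it. * *Non-anonymous processes with atomic snapshot objects*: processes $P_0,\dots,P_{n-1}$, whose code may depend on their index, share an arbitrary family of $n$-ary atomic snapshot objects with arbitrary fixed initial contents; a step of $P_i$ either writes a value to the $i$-th component of one object (update) or reads all $n$ components of one object (scan). * *Anonymous processes with atomic weak set objects*: $n$ processes run one and the same code, started from an initial state that depends only on the input, and share finitely many atomic weak sets over an arbitrary value set, all initially empty; a step either adds a value to one weak set (add) or returns the set of all values added to one weak set so far (get). **Colorless tasks.** A colorless task is a triple $(\mathcal I,\mathcal O,\Delta)$ of abstract simplicial complexes $\mathcal I,\mathcal O$ and a map $\Delta$ that assigns to each simplex $s\in\mathcal I$ a subcomplex $\Delta(s)$ of $\mathcal O$, with $\Delta(s')\subseteq\Delta(s)$ whenever $s'\subseteq s$. A protocol for $n$ processes solves it $t$-resiliently if for every $s\in\mathcal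 I$, all inputs in $s$ (repetitions allowed) and every $t$-resilient execution with these inputs, every process that does not crash decides and the set of all decided values is a simplex of $\Delta(s)$. **Statement.** 1. (Anonymous BG simulation.) For every protocol $P$ of $n$ non-anonymous processes with atomic snapshot objects there is a protocol $Q$ for $n$ anonymous processes with atomic weak set objects such that for every $t$-resilient execution $\rho$ of $Q$ there is a $t$-resilient execution $\rho'$ of $P$ with the following properties: every input in $\rho'$ is the input of some process in $\rho$; every value decided in $\rho$ is decided by some process in $\rho'$; and if some process that does not crash in $\rho'$ decides in $\rho'$, then every process that does not crash in $\rho$ decides in $\rho$. 2. Consequently, every colorless task that is $t$-resilient solvable by $n$ non-anonymous processes with atomic snapshot objects is $t$-resilient solvable by $n$ anonymous processes with atomic weak set objects. -/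

import Mathlib

universe u

namespace Resilient

/-! ### Colorless tasks -/

/-- A colorless task: an input complex, an output complex and a carrier map between them.
Only the values of `carrier` on simplices of `input` matter. The vertices of a complex are the
points `v` with `{v}` a simplex. -/
structure ColorlessTask (A B : Type u) where
  input : PreAbstractSimplicialComplex A
  output : PreAbstractSimplicialComplex B
  carrier : Finset A → PreAbstractSimplicialComplex B
  carrier_le : ∀ s ∈ input, carrier s ≤ output
  carrier_mono : ∀ s ∈ input, ∀ s' ∈ input, s' ⊆ s → carrier s' ≤ carrier s

/-! ### Schedules and crash failures

An execution of `n` deterministic asynchronous processes is driven by a schedule that names, for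
every time instant, the process that performs the next atomic step. A process that has decided
performs only idle steps. A process crashes if it is scheduled only finitely often. -/

/-- The process `i` crashes in the schedule `σ`. -/
def Faulty {n : ℕ} (σ : ℕ → Fin n) (i : Fin n) : Prop :=
  {k : ℕ | σ k = i}.Finite

/-- At most `t` processes crash in the schedule `σ`. -/
def AtMostFaulty {n : ℕ} (t : ℕ) (σ : ℕ → Fin n) : Prop :=
  {i : Fin n | Faulty σ i}.ncard ≤ t

/-- The decisions `D` of the processes (`D i b`: process `i` decides `b`) in an execution with
schedule `σ` are correct for the input simplex `s` of the task `T`: every process that does not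
crash decides, and the decided values form a simplex of the image of `s`. -/
def ColorlessTask.Correct {A B : Type u} (T : ColorlessTask A B) {n : ℕ} (s : Finset A)
    (σ : ℕ → Fin n) (D : Fin n → B → Prop) : Prop :=
  (∀ i, ¬ Faulty σ i → ∃ b, D i b) ∧
    ∃ s' ∈ T.carrier s, (s' : Set B) = {b | ∃ i, D i b}

/-! ### Non-anonymous processes with atomic snapshot objects -/

/-- What a process of a snapshot protocol does next, depending on its local state: halt with a
decision, write a value to its own component of a snapshot object, or atomically read all `n`
components of a snapshot object. -/
inductive SnapshotAction (n : ℕ) (Obj Val State B : Type u) : Type u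
  | decide (b : B)
  | update (j : Obj) (w : Val) (next : State)
  | scan (j : Obj) (next : (Fin n → Val) → State)

/-- A protocol for `n` processes with names `i : Fin n` that communicate through a family of
`n`-ary atomic snapshot objects. The code depends on the name. -/
structure SnapshotProtocol (n : ℕ) (A B : Type u) where
  Obj : Type u
  Val : Type u
  State : Type u
  /-- initial contents of the snapshot objects -/
  mem₀ : Obj → Fin n → Val
  /-- initial local state for a given input -/
  start : Fin n → A → State
  code : Fin n → State → SnapshotAction n Obj Val State B

namespace SnapshotProtocol

variable {n : ℕ} {A B : Type u} (P : SnapshotProtocol n A B)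

/-- Global configurations. -/
structure Config where
  loc : Fin n → P.State
  mem : P.Obj → Fin n → P.Val

open scoped Classical in
/-- The atomic step of process `i`. -/
noncomputable def step (c : P.Config) (i : Fin n) : P.Config :=
  match P.code i (c.loc i) with
  | .decide _ => c
  | .update j w q =>
      ⟨Function.update c.loc i q, Function.update c.mem j (Function.update (c.mem j) i w)⟩
  | .scan j q => ⟨Function.update c.loc i (q (c.mem j)), c.mem⟩

/-- The configuration after `k` steps of the execution with inputs `x` and schedule `σ`. -/
noncomputable def run (x : Fin n → A) (σ : ℕ → Fin n) : ℕ → P.Config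
  | 0 => ⟨fun i => P.start i (x i), P.mem₀⟩
  | k + 1 => P.step (run x σ k) (σ k)

/-- Process `i` decides `b` in the execution with inputs `x` and schedule `σ`. -/
def Decides (x : Fin n → A) (σ : ℕ → Fin n) (i : Fin n) (b : B) : Prop :=
  ∃ k, P.code i ((P.run x σ k).loc i) = .decide b

/-- The protocol solves the task when at most `t` processes crash. -/
def Solves (t : ℕ) (T : ColorlessTask A B) : Prop :=
  ∀ s ∈ T.input, ∀ x : Fin n → A, (∀ i, x i ∈ s) →
    ∀ σ : ℕ → Fin n, AtMostFaulty t σ → T.Correct s σ (P.Decides x σ)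

end SnapshotProtocol

/-! ### Anonymous processes with atomic weak set objects -/

/-- What a process of a weak set protocol does next, depending on its local state: halt with a
decision, add a value to a weak set object, or get the set of all values added so far to a weak
set object. -/
inductive WeakSetAction (m : ℕ) (Val State B : Type u) : Type u
  | decide (b : B)
  | add (j : Fin m) (v : Val) (next : State)
  | get (j : Fin m) (next : Set Val → State)

/-- An anonymous protocol that uses finitely many atomic weak set objects: all processes run the
same code, and the initial state of a process depends on its input only. -/
structure WeakSetProtocol (A B : Type u) where
  numObj : ℕ
  Val : Type u
  State : Type u
  start : A → State
  code : State → WeakSetAction numObj Val State B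

namespace WeakSetProtocol

variable {A B : Type u} (Q : WeakSetProtocol A B)

/-- Global configurations of `n` processes. -/
structure Config (n : ℕ) where
  loc : Fin n → Q.State
  mem : Fin Q.numObj → Set Q.Val

/-- The atomic step of process `i`. -/
def step {n : ℕ} (c : Q.Config n) (i : Fin n) : Q.Config n :=
  match Q.code (c.loc i) with
  | .decide _ => c
  | .add j v q => ⟨Function.update c.loc i q, Function.update c.mem j (insert v (c.mem j))⟩
  | .get j q => ⟨Function.update c.loc i (q (c.mem j)), c.mem⟩

/-- The configuration after `k` steps of the execution with inputs `x` and schedule `σ`. All weak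
sets are initially empty. -/
def run {n : ℕ} (x : Fin n → A) (σ : ℕ → Fin n) : ℕ → Q.Config n
  | 0 => ⟨fun i => Q.start (x i), fun _ => ∅⟩
  | k + 1 => Q.step (run x σ k) (σ k)

/-- Process `i` decides `b` in the execution with inputs `x` and schedule `σ`. -/
def Decides {n : ℕ} (x : Fin n → A) (σ : ℕ → Fin n) (i : Fin n) (b : B) : Prop :=
  ∃ k, Q.code ((Q.run x σ k).loc i) = .decide b

/-- The protocol, run by `n` anonymous processes, solves the task when at most `t` of them
crash. -/
def Solves (n t : ℕ) (T : ColorlessTask A B) : Prop :=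
  ∀ s ∈ T.input, ∀ x : Fin n → A, (∀ i, x i ∈ s) →
    ∀ σ : ℕ → Fin n, AtMostFaulty t σ → T.Correct s σ (Q.Decides x σ)

/-- `n` anonymous processes running `Q`, at most `t` of which crash, simulate `n` non-anonymous
processes running `P`, at most `t` of which crash: to every execution of `Q` with at most `t`
crashes belongs an execution of `P` with at most `t` crashes, whose inputs are inputs of the
simulators, such that every value decided by a simulator is decided by a simulated process, and
if some simulated process that does not crash decides, then so does every simulator that does not
crash. -/
def Simulates {n : ℕ} (t : ℕ) (P : SnapshotProtocol n A B) : Prop :=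
  ∀ (x : Fin n → A) (σ : ℕ → Fin n), AtMostFaulty t σ →
    ∃ (x' : Fin n → A) (σ' : ℕ → Fin n), AtMostFaulty t σ' ∧
      Set.range x' ⊆ Set.range x ∧
      (∀ i b, Q.Decides x σ i b → ∃ j, P.Decides x' σ' j b) ∧
      ((∃ j, ¬ Faulty σ' j ∧ ∃ b, P.Decides x' σ' j b) →
        ∀ i, ¬ Faulty σ i → ∃ b, Q.Decides x σ i b)

end WeakSetProtocol

/-- The task is `t`-resilient solvable by `n` non-anonymous processes with atomic snapshot
objects. -/
def SolvableNonAnonymously {A B : Type u} (n t : ℕ) (T : ColorlessTask A B) : Prop :=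
  ∃ P : SnapshotProtocol n A B, P.Solves t T

/-- The task is `t`-resilient solvable by `n` anonymous processes with atomic weak set objects. -/
def SolvableAnonymously {A B : Type u} (n t : ℕ) (T : ColorlessTask A B) : Prop :=
  ∃ Q : WeakSetProtocol A B, Q.Solves n t T

end Resilient

/-! Every simulator runs all processes of `P`. For each simulated process `j` the simulators agree,
one after the other, on its successive states; the instance of agreement that fixes the `k`-th
state proceeds in rounds. In a round a simulator first passes a gate: it enters with its current
value, leaves with a flag saying that it saw nobody leave with flag `true` before, and waits until
everybody seen to have entered has left. It then adopts a value chosen from the set of values that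
left with flag `true`, and a commit-adopt phase follows.

If everybody adopts from the same set, the round ends in agreement. Anonymity is the obstacle:
simulators in the same local state add the same message and count as one, so that one of them may
still be inside the gate when its twin has left and the gate looks empty. The set grows after that
only if the late twin leaves with flag `true` and the early one left with flag `false`. The gate
messages therefore carry the history of all flags obtained so far: two simulators that are confused
in this way have different histories ever after, so each pair is confused at most once, and only
finitely many rounds fail.

A crashed simulator blocks an instance only if it crashes inside its gate, and it is inside at most
one gate, so that at most as many simulated processes are blocked as simulators crash. Finally, an
update of a simulated process takes effect when the state following it is first announced, a scan
at the read of the weak set from which the state following it was computed, and the order of these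
instants is the schedule of the simulated execution. -/

namespace Resilient

/-! ### The agreement protocol -/

/-- The outcomes of the gate operations a simulator has performed so far: an entry `(e, r, b)`
records that it left round `r` of the agreement instance `e` with flag `b`. The instance
`(j, k)` is the one that fixes the `k`-th state of the simulated process `j`. -/
abbrev History (n : ℕ) : Type := List ((Fin n × ℕ) × ℕ × Bool)

/-- The values added to the weak set. Every message names an agreement instance `e` and a value
`w` of it: `enter` and `leave` are the two halves of the gate of round `r`, and `dec` announces
that `w` is agreed upon. -/
inductive Msg (n : ℕ) (W : Type u) : Type u
  | enter (e : Fin n × ℕ) (r : ℕ) (h : History n) (w : W)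
  | leave (e : Fin n × ℕ) (r : ℕ) (h : History n) (w : W) (b : Bool)
  | propose (e : Fin n × ℕ) (r : ℕ) (w : W)
  | vote (e : Fin n × ℕ) (r : ℕ) (b : Bool) (w : W)
  | dec (e : Fin n × ℕ) (w : W)

/-- The position of a simulator within a round of an agreement instance; `waiting` comprises the
passage through the gate. -/
inductive Phase : Type
  | start
  | waiting
  | proposed
  | voted

/-- The progress of a simulator with one simulated process: it takes part in round `round` of the
instance number `idx` of this process, with current value `val`. -/
structure Slot (W : Type u) : Type u where
  idx : ℕ
  round : ℕ
  phase : Phase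
  val : W

/-- What a simulator does in its next step: read the weak set (`ready`), add a message to it
(`pend`), read the weak set inside a gate it has entered (`inside`), or nothing (`done`). -/
inductive Mode (n : ℕ) (W B : Type u) : Type u
  | ready
  | pend (m : Msg n W)
  | inside (e : Fin n × ℕ) (r : ℕ) (w : W)
  | done (b : B)

/-- The local state of a simulator. It attends to the simulated processes in cyclic order, and
`turn` counts its visits. -/
structure SimState (n : ℕ) (W B : Type u) : Type u where
  turn : ℕ
  hist : History n
  slot : Fin n → Slot W
  mode : Mode n W B

/-- The parameters of the agreement protocol: simulators agree, for every `j`, on a chain of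
values. A simulator with input `a` proposes `init j a` as value number `0`; having learned that
`w` is value number `k`, it reads `S` from the weak set and proposes `next j w S` as value number
`k + 1`; it halts with `b` when it reads `S` with `out S = some b`. -/
structure ChainSpec (n : ℕ) (A B W : Type u) : Type u where
  init : Fin n → A → W
  next : Fin n → W → Set (Msg n W) → W
  out : Set (Msg n W) → Option B

/-- The values of those who left round `r` of instance `e` before anybody else was seen to have
left it with flag `true`. -/
def winners {n : ℕ} {W : Type u} (S : Set (Msg n W)) (e : Fin n × ℕ) (r : ℕ) : Set W :=
  {w | ∃ h, .leave e r h w true ∈ S}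

/-- The gate of round `r` of instance `e` has a winner, and nobody is inside it. -/
def Settled {n : ℕ} {W : Type u} (S : Set (Msg n W)) (e : Fin n × ℕ) (r : ℕ) : Prop :=
  (winners S e r).Nonempty ∧ ∀ h w, .enter e r h w ∈ S → ∃ b, .leave e r h w b ∈ S

/-- The activity of a simulator with which message, if any, it adds next. -/
def Mode.after {n : ℕ} {W B : Type u} : Option (Msg n W) → Mode n W B
  | none => .ready
  | some m => .pend m

/-- The activity of a simulator that has just added a message. -/
def Msg.resume {n : ℕ} {W B : Type u} : Msg n W → Mode n W B
  | .enter e r _ w => .inside e r w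
  | _ => .ready

/-- The simulated process a simulator attends to. -/
def SimState.cur {n : ℕ} {W B : Type u} [NeZero n] (s : SimState n W B) : Fin n :=
  Fin.ofNat n s.turn

section

variable {n : ℕ} {A B W : Type u}

/-- The treatment of the simulated process `j` by a simulator with history `h` that has read `S`:
its slot for `j` changes, and possibly a message is to be added. The rounds are those of a
commit-adopt protocol. -/
inductive Move (I : ChainSpec n A B W) (j : Fin n) (h : History n) (S : Set (Msg n W))
    (s : Slot W) : Slot W → Option (Msg n W) → Prop
  | advance {w : W} (hw : .dec (j, s.idx) w ∈ S) :
      Move I j h S s ⟨s.idx + 1, 0, .start, I.next j w S⟩ none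
  | enter (hp : s.phase = .start) (hu : ∀ w, .dec (j, s.idx) w ∉ S) :
      Move I j h S s { s with phase := .waiting } (some (.enter (j, s.idx) s.round h s.val))
  | wait (hp : s.phase = .waiting) (hu : ∀ w, .dec (j, s.idx) w ∉ S)
      (hs : ¬ Settled S (j, s.idx) s.round) : Move I j h S s s none
  | propose (hp : s.phase = .waiting) (hu : ∀ w, .dec (j, s.idx) w ∉ S)
      (hs : Settled S (j, s.idx) s.round) :
      Move I j h S s ⟨s.idx, s.round, .proposed, hs.1.some⟩
        (some (.propose (j, s.idx) s.round hs.1.some))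
  | vote (hp : s.phase = .proposed) (hu : ∀ w, .dec (j, s.idx) w ∉ S) {b : Bool}
      (hb : b = true ↔ ∀ w, .propose (j, s.idx) s.round w ∈ S → w = s.val) :
      Move I j h S s { s with phase := .voted } (some (.vote (j, s.idx) s.round b s.val))
  | commit (hp : s.phase = .voted) (hu : ∀ w, .dec (j, s.idx) w ∉ S)
      (hv : ∀ b w, .vote (j, s.idx) s.round b w ∈ S → b = true ∧ w = s.val) :
      Move I j h S s s (some (.dec (j, s.idx) s.val))
  | retry (hp : s.phase = .voted) (hu : ∀ w, .dec (j, s.idx) w ∉ S)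
      (hv : ¬ ∀ b w, .vote (j, s.idx) s.round b w ∈ S → b = true ∧ w = s.val) {w : W}
      (hw : .vote (j, s.idx) s.round true w ∈ S ∨
        (∀ w', .vote (j, s.idx) s.round true w' ∉ S) ∧ w = s.val) :
      Move I j h S s ⟨s.idx, s.round + 1, .start, w⟩ none

theorem Move.total (I : ChainSpec n A B W) (j : Fin n) (h : History n) (S : Set (Msg n W))
    (s : Slot W) : ∃ s' o, Move I j h S s s' o := by
  by_cases hu : ∃ w, .dec (j, s.idx) w ∈ S
  · obtain ⟨w, hw⟩ := hu
    exact ⟨_, _, .advance hw⟩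
  push Not at hu
  cases hp : s.phase with
  | start => exact ⟨_, _, .enter hp hu⟩
  | waiting =>
    by_cases hs : Settled S (j, s.idx) s.round
    exacts [⟨_, _, .propose hp hu hs⟩, ⟨_, _, .wait hp hu hs⟩]
  | proposed =>
    classical
    exact ⟨_, _, .vote hp hu (b := decide (∀ w, .propose (j, s.idx) s.round w ∈ S → w = s.val))
      decide_eq_true_iff⟩
  | voted =>
    by_cases hv : ∀ b w, .vote (j, s.idx) s.round b w ∈ S → b = true ∧ w = s.val
    · exact ⟨_, _, .commit hp hu hv⟩
    by_cases ht : ∃ w, .vote (j, s.idx) s.round true w ∈ S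
    · exact ⟨_, _, .retry hp hu hv (.inl ht.choose_spec)⟩
    · exact ⟨_, _, .retry hp hu hv (.inr ⟨not_exists.mp ht, rfl⟩)⟩

end

section

variable {n : ℕ} {A B W : Type u} [NeZero n]

/-- The reaction of a simulator in state `s` to reading `S`. Inside a gate it leaves, claiming to
be a winner (`b = true`) unless it sees one, and recording this in its history. -/
inductive Reaction (I : ChainSpec n A B W) (S : Set (Msg n W)) (s : SimState n W B) :
    SimState n W B → Prop
  | halt {b : B} (hm : s.mode = .ready) (ho : I.out S = some b) :
      Reaction I S s { s with mode := .done b }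
  | move {s' : Slot W} {o : Option (Msg n W)} (hm : s.mode = .ready) (ho : I.out S = none)
      (h : Move I s.cur s.hist S (s.slot s.cur) s' o) :
      Reaction I S s ⟨s.turn + 1, s.hist, Function.update s.slot s.cur s', .after o⟩
  | leave {e : Fin n × ℕ} {r : ℕ} {w : W} {b : Bool} (hm : s.mode = .inside e r w)
      (hb : b = true ↔ ∀ h u, .leave e r h u true ∉ S) :
      Reaction I S s { s with
        hist := s.hist ++ [(e, r, b)], mode := .pend (.leave e r s.hist w b) }

theorem Reaction.exists_of_ready (I : ChainSpec n A B W) (S : Set (Msg n W))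
    {s : SimState n W B} (hm : s.mode = .ready) : ∃ s', Reaction I S s s' := by
  cases ho : I.out S with
  | none =>
    obtain ⟨s', o, h⟩ := Move.total I s.cur s.hist S (s.slot s.cur)
    exact ⟨_, .move hm ho h⟩
  | some b => exact ⟨_, .halt hm ho⟩

theorem Reaction.exists_of_inside (I : ChainSpec n A B W) (S : Set (Msg n W))
    {s : SimState n W B} {e : Fin n × ℕ} {r : ℕ} {w : W} (hm : s.mode = .inside e r w) :
    ∃ s', Reaction I S s s' := by
  classical
  exact ⟨_, .leave hm (b := decide (∀ h u, .leave e r h u true ∉ S)) decide_eq_true_iff⟩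

/-- A simulator step, as a change of the contents of the weak set and of the local state. -/
inductive Step (I : ChainSpec n A B W) (S : Set (Msg n W)) (s : SimState n W B) :
    Set (Msg n W) → SimState n W B → Prop
  | react {s' : SimState n W B} (h : Reaction I S s s') : Step I S s S s'
  | write {m : Msg n W} (hm : s.mode = .pend m) :
      Step I S s (insert m S) { s with mode := m.resume }
  | idle {b : B} (hm : s.mode = .done b) : Step I S s S s

/-- An execution of the agreement protocol: the contents of the weak set and the states of the
simulators at all times. -/
structure Exec {m : ℕ} (I : ChainSpec n A B W) (x : Fin m → A) (σ : ℕ → Fin m) where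
  mem : ℕ → Set (Msg n W)
  st : ℕ → Fin m → SimState n W B
  mem_zero : mem 0 = ∅
  st_zero : ∀ p, st 0 p = ⟨0, [], fun j => ⟨0, 0, .start, I.init j (x p)⟩, .ready⟩
  step : ∀ τ, Step I (mem τ) (st τ (σ τ)) (mem (τ + 1)) (st (τ + 1) (σ τ))
  other : ∀ τ p, p ≠ σ τ → st (τ + 1) p = st τ p

end

namespace WeakSetProtocol

variable {A B : Type u} (Q : WeakSetProtocol A B) {m : ℕ} {c : Q.Config m} {i : Fin m}

theorem step_of_decide {b : B} (h : Q.code (c.loc i) = .decide b) : Q.step c i = c := by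
  simp only [step, h]

theorem step_of_add {j : Fin Q.numObj} {v : Q.Val} {q : Q.State}
    (h : Q.code (c.loc i) = .add j v q) :
    (Q.step c i).mem j = insert v (c.mem j) ∧ (Q.step c i).loc i = q := by
  simp only [step, h, Function.update_self, and_self]

theorem step_of_get {j : Fin Q.numObj} {q : Set Q.Val → Q.State}
    (h : Q.code (c.loc i) = .get j q) :
    (Q.step c i).mem = c.mem ∧ (Q.step c i).loc i = q (c.mem j) := by
  simp only [step, h, Function.update_self, and_self]

theorem step_loc_of_ne {p : Fin m} (h : p ≠ i) : (Q.step c i).loc p = c.loc p := by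
  unfold step
  split
  exacts [rfl, Function.update_of_ne h _ _, Function.update_of_ne h _ _]

end WeakSetProtocol

namespace ChainSpec

variable {n : ℕ} {A B W : Type u} [NeZero n] (I : ChainSpec n A B W)

open scoped Classical in
/-- The reaction of a simulator that performs a read. -/
noncomputable def react (s : SimState n W B) (S : Set (Msg n W)) : SimState n W B :=
  if h : ∃ s', Reaction I S s s' then h.choose else s

theorem reaction_react {s : SimState n W B} {S : Set (Msg n W)} (h : ∃ s', Reaction I S s s') :
    Reaction I S s (I.react s S) := by
  rw [react, dif_pos h]
  exact h.choose_spec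

/-- The agreement protocol, as an anonymous protocol with a single weak set. -/
noncomputable def protocol : WeakSetProtocol A B where
  numObj := 1
  Val := Msg n W
  State := SimState n W B
  start a := ⟨0, [], fun j => ⟨0, 0, .start, I.init j a⟩, .ready⟩
  code s :=
    match s.mode with
    | .ready | .inside _ _ _ => .get 0 (I.react s)
    | .pend m => .add 0 m { s with mode := m.resume }
    | .done b => .decide b

theorem step_protocol {m : ℕ} (c : I.protocol.Config m) (p : Fin m) :
    Step I (c.mem (0 : Fin 1)) (c.loc p) ((I.protocol.step c p).mem (0 : Fin 1))
      ((I.protocol.step c p).loc p) := by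
  have of_get (h : ∃ s', Reaction I (c.mem (0 : Fin 1)) (c.loc p) s')
      (hc : I.protocol.code (c.loc p) = .get (0 : Fin 1) (I.react (c.loc p))) :
      Step I (c.mem (0 : Fin 1)) (c.loc p) ((I.protocol.step c p).mem (0 : Fin 1))
        ((I.protocol.step c p).loc p) := by
    rw [(I.protocol.step_of_get hc).1, (I.protocol.step_of_get hc).2]
    exact .react (I.reaction_react h)
  match hm : SimState.mode (c.loc p) with
  | .ready => exact of_get (Reaction.exists_of_ready I _ hm) (by simp only [protocol, hm])
  | .inside e r w => exact of_get (Reaction.exists_of_inside I _ hm) (by simp only [protocol, hm])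
  | .pend msg =>
    have hc : I.protocol.code (c.loc p) =
        .add (0 : Fin 1) msg { (c.loc p : SimState n W B) with mode := msg.resume } := by
      simp only [protocol, hm]
    rw [(I.protocol.step_of_add hc).1, (I.protocol.step_of_add hc).2]
    exact .write hm
  | .done b =>
    rw [I.protocol.step_of_decide (b := b) (by simp only [protocol, hm])]
    exact .idle hm

/-- The execution of the agreement protocol with given inputs and schedule. -/
noncomputable def exec {m : ℕ} (x : Fin m → A) (σ : ℕ → Fin m) : Exec I x σ where
  mem τ := (I.protocol.run x σ τ).mem (0 : Fin 1)
  st τ := (I.protocol.run x σ τ).loc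
  mem_zero := rfl
  st_zero _ := rfl
  step τ := I.step_protocol (I.protocol.run x σ τ) (σ τ)
  other _ _ hp := I.protocol.step_loc_of_ne hp

theorem decides_protocol_iff {m : ℕ} {x : Fin m → A} {σ : ℕ → Fin m} {p : Fin m} {b : B} :
    I.protocol.Decides x σ p b ↔ ∃ τ, ((I.exec x σ).st τ p).mode = .done b := by
  refine exists_congr fun τ => ?_
  change I.protocol.code ((I.exec x σ).st τ p) = _ ↔ _
  cases hm : ((I.exec x σ).st τ p).mode <;> simp [protocol, hm]

end ChainSpec

/-! ### Where messages come from -/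

/-- The message a simulator is about to add. -/
def Mode.pending {n : ℕ} {W B : Type u} : Mode n W B → Set (Msg n W)
  | .pend m => {m}
  | _ => ∅

/-- The slot `s` for the simulated process `j` is accounted for by a message in `S`: whoever is
past the start of a round has added a message with its current value. -/
def Slot.Backed {n : ℕ} {W : Type u} (j : Fin n) (S : Set (Msg n W)) (s : Slot W) : Prop :=
  match s.phase with
  | .start => True
  | .waiting => ∃ h, .enter (j, s.idx) s.round h s.val ∈ S
  | .proposed => .propose (j, s.idx) s.round s.val ∈ S
  | .voted => ∃ b, .vote (j, s.idx) s.round b s.val ∈ S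

/-- The local state `s` is accounted for by the messages in `S` and the one about to be added. -/
structure SimState.Backed {n : ℕ} {W B : Type u} (S : Set (Msg n W)) (s : SimState n W B) :
    Prop where
  slot : ∀ j, (s.slot j).Backed j (S ∪ s.mode.pending)
  hist_of_pend : ∀ {e r h w}, s.mode = .pend (.enter e r h w) → h = s.hist
  enter_of_inside : ∀ {e r w}, s.mode = .inside e r w → .enter e r s.hist w ∈ S

theorem Slot.Backed.mono {n : ℕ} {W : Type u} {j : Fin n} {S S' : Set (Msg n W)} {s : Slot W}
    (h : s.Backed j S) (hS : S ⊆ S') : s.Backed j S' := by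
  unfold Slot.Backed at *
  cases hp : s.phase <;> simp only [hp] at h ⊢
  · exact h.imp fun _ => @hS _
  · exact hS h
  · exact h.imp fun _ => @hS _

theorem SimState.Backed.mono {n : ℕ} {W B : Type u} {S S' : Set (Msg n W)} {s : SimState n W B}
    (h : s.Backed S) (hS : S ⊆ S') : s.Backed S' :=
  ⟨fun j => (h.slot j).mono (Set.union_subset_union_left _ hS), h.hist_of_pend,
    fun hm => hS (h.enter_of_inside hm)⟩

theorem Msg.resume_eq_inside {n : ℕ} {W B : Type u} {m : Msg n W} {e : Fin n × ℕ} {r : ℕ} {w : W}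
    (h : (m.resume : Mode n W B) = .inside e r w) : ∃ h, m = .enter e r h w := by
  cases m <;> cases h
  exact ⟨_, rfl⟩

theorem Msg.resume_ne_pend {n : ℕ} {W B : Type u} (m m' : Msg n W) :
    (m.resume : Mode n W B) ≠ .pend m' := by
  cases m <;> exact nofun

theorem Mode.after_eq_pend {n : ℕ} {W B : Type u} {o : Option (Msg n W)} {m : Msg n W}
    (h : (after o : Mode n W B) = .pend m) : o = some m := by
  cases o <;> cases h
  rfl

theorem Mode.after_ne_inside {n : ℕ} {W B : Type u} (o : Option (Msg n W)) {e : Fin n × ℕ} {r : ℕ}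
    {w : W} : (after o : Mode n W B) ≠ .inside e r w := by
  cases o <;> exact nofun

namespace Move

variable {n : ℕ} {A B W : Type u} {I : ChainSpec n A B W} {j : Fin n} {h : History n}
  {S : Set (Msg n W)} {s s' : Slot W} {o : Option (Msg n W)}

theorem backed (hmove : Move I j h S s s' o) (hs : s.Backed j S) :
    s'.Backed j (S ∪ (Mode.after o : Mode n W B).pending) := by
  cases hmove with
  | advance | retry => exact trivial
  | enter => exact ⟨h, .inr rfl⟩
  | wait => exact hs.mono Set.subset_union_left
  | propose => exact .inr rfl
  | vote => exact ⟨_, .inr rfl⟩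
  | commit => exact hs.mono Set.subset_union_left

theorem eq_hist_of_enter {e : Fin n × ℕ} {r : ℕ} {h' : History n} {w : W}
    (hmove : Move I j h S s s' (some (.enter e r h' w))) : h' = h := by
  cases hmove
  rfl

end Move

namespace Step

variable {n : ℕ} {A B W : Type u} [NeZero n] {I : ChainSpec n A B W} {S S' : Set (Msg n W)}
  {s s' : SimState n W B}

theorem of_ready (h : Step I S s S' s') (hm : s.mode = .ready) :
    S' = S ∧ ((∃ b, I.out S = some b ∧ s' = { s with mode := .done b }) ∨
      I.out S = none ∧ ∃ t o, Move I s.cur s.hist S (s.slot s.cur) t o ∧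
        s' = ⟨s.turn + 1, s.hist, Function.update s.slot s.cur t, .after o⟩) := by
  cases h with
  | react h =>
    cases h with
    | halt _ ho => exact ⟨rfl, .inl ⟨_, ho, rfl⟩⟩
    | move _ ho h => exact ⟨rfl, .inr ⟨ho, _, _, h, rfl⟩⟩
    | leave hm' => cases hm.symm.trans hm'
  | write hm' | idle hm' => cases hm.symm.trans hm'

theorem of_inside (h : Step I S s S' s') {e : Fin n × ℕ} {r : ℕ} {w : W}
    (hm : s.mode = .inside e r w) :
    S' = S ∧ ∃ b, (b = true ↔ ∀ h u, .leave e r h u true ∉ S) ∧ s' = { s with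
      hist := s.hist ++ [(e, r, b)], mode := .pend (.leave e r s.hist w b) } := by
  cases h with
  | react h =>
    cases h with
    | halt hm' | move hm' => cases hm.symm.trans hm'
    | leave hm' hb =>
      cases hm.symm.trans hm'
      exact ⟨rfl, _, hb, rfl⟩
  | write hm' | idle hm' => cases hm.symm.trans hm'

theorem of_pend (h : Step I S s S' s') {m : Msg n W} (hm : s.mode = .pend m) :
    S' = insert m S ∧ s' = { s with mode := m.resume } := by
  cases h with
  | react h => cases h with | halt hm' | move hm' | leave hm' => cases hm.symm.trans hm'
  | write hm' =>
    cases hm.symm.trans hm'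
    exact ⟨rfl, rfl⟩
  | idle hm' => cases hm.symm.trans hm'

theorem of_done (h : Step I S s S' s') {b : B} (hm : s.mode = .done b) : S' = S ∧ s' = s := by
  cases h with
  | react h => cases h with | halt hm' | move hm' | leave hm' => cases hm.symm.trans hm'
  | write hm' => cases hm.symm.trans hm'
  | idle => exact ⟨rfl, rfl⟩

theorem slot_eq_or_move (h : Step I S s S' s') (j : Fin n) :
    s'.slot j = s.slot j ∨ s.mode = .ready ∧ s.cur = j ∧
      ∃ o, Move I j s.hist S (s.slot j) (s'.slot j) o ∧ s'.mode = .after o := by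
  cases h with
  | react h =>
    cases h with
    | halt | leave => exact .inl rfl
    | move hm _ h =>
      by_cases hj : s.cur = j
      · subst hj
        refine .inr ⟨hm, rfl, _, ?_, rfl⟩
        simpa only [Function.update_self] using h
      · exact .inl (Function.update_of_ne (Ne.symm hj) _ _)
  | write | idle => exact .inl rfl

theorem union_pending_subset (h : Step I S s S' s') :
    S ∪ s.mode.pending ⊆ S' ∪ s'.mode.pending := by
  cases h with
  | react h =>
    cases h with | halt hm | move hm | leave hm => simp [hm, Mode.pending]
  | write hm =>
    simp only [hm, Mode.pending, Set.union_singleton, Set.subset_union_left]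
  | idle => rfl

theorem subset (h : Step I S s S' s') : S ⊆ S' := by
  cases h with
  | react | idle => rfl
  | write => exact Set.subset_insert _ _

theorem backed (h : Step I S s S' s') (hs : s.Backed S) : s'.Backed S' := by
  refine ⟨fun j => ?_, ?_, ?_⟩
  · rcases h.slot_eq_or_move j with heq | ⟨hm, -, o, hmove, ho⟩
    · rw [heq]
      exact (hs.slot j).mono h.union_pending_subset
    · have hsj : (s.slot j).Backed j S := by simpa [hm, Mode.pending] using hs.slot j
      rw [ho]
      exact (hmove.backed hsj).mono (Set.union_subset_union_left _ h.subset)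
  · intro e r h' w hm'
    cases h with
    | react h =>
      cases h with
      | halt => cases hm'
      | move _ _ h =>
        obtain rfl := Mode.after_eq_pend hm'
        exact h.eq_hist_of_enter
      | leave => cases hm'
    | write => exact absurd hm' (Msg.resume_ne_pend _ _)
    | idle => exact hs.hist_of_pend hm'
  · intro e r w hm'
    cases h with
    | react h =>
      cases h with
      | halt | leave => cases hm'
      | move => exact absurd hm' (Mode.after_ne_inside _)
    | write hm =>
      obtain ⟨h', rfl⟩ := Msg.resume_eq_inside hm'
      exact hs.hist_of_pend hm ▸ Set.mem_insert _ _
    | idle => exact hs.enter_of_inside hm'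

end Step

namespace Exec

variable {n m : ℕ} {A B W : Type u} [NeZero n] {I : ChainSpec n A B W} {x : Fin m → A}
  {σ : ℕ → Fin m} (E : Exec I x σ)

theorem mem_mono : Monotone E.mem :=
  monotone_nat_of_le_succ fun τ => (E.step τ).subset

theorem backed (τ : ℕ) (p : Fin m) : (E.st τ p).Backed (E.mem τ) := by
  induction τ with
  | zero => rw [E.st_zero]; exact ⟨fun _ => trivial, nofun, nofun⟩
  | succ τ ih =>
    by_cases hp : p = σ τ
    · exact hp ▸ (E.step τ).backed (hp ▸ ih)
    · exact E.other τ p hp ▸ ih.mono (E.mem_mono τ.le_succ)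

theorem backed_of_ready {τ : ℕ} {p : Fin m} (hm : (E.st τ p).mode = .ready) (j : Fin n) :
    ((E.st τ p).slot j).Backed j (E.mem τ) := by
  simpa [hm, Mode.pending] using (E.backed τ p).slot j

/-- At time `τ` the simulator that takes a step chooses to add `msg` in its next step. -/
def Issues (τ : ℕ) (msg : Msg n W) : Prop :=
  Reaction I (E.mem τ) (E.st τ (σ τ)) (E.st (τ + 1) (σ τ)) ∧
    (E.st (τ + 1) (σ τ)).mode = .pend msg

variable {E} {τ : ℕ}

theorem exists_issues_of_pend {p : Fin m} {msg : Msg n W} (h : (E.st τ p).mode = .pend msg) :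
    ∃ τ' < τ, E.Issues τ' msg := by
  induction τ with
  | zero => rw [E.st_zero] at h; cases h
  | succ τ ih =>
    by_cases hp : p = σ τ
    · subst hp
      have hstep := E.step τ
      generalize hS : E.mem (τ + 1) = S' at hstep
      generalize hs : E.st (τ + 1) (σ τ) = s' at h hstep
      cases hstep with
      | react hr => exact ⟨τ, τ.lt_succ_self, hs ▸ hr, hs ▸ h⟩
      | write => exact absurd h (Msg.resume_ne_pend _ _)
      | idle =>
        obtain ⟨τ', hτ', h'⟩ := ih h
        exact ⟨τ', hτ'.trans τ.lt_succ_self, h'⟩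
    · obtain ⟨τ', hτ', h'⟩ := ih (E.other τ p hp ▸ h)
      exact ⟨τ', hτ'.trans τ.lt_succ_self, h'⟩

theorem exists_pend_of_mem {msg : Msg n W} (h : msg ∈ E.mem τ) :
    ∃ τ' < τ, (E.st τ' (σ τ')).mode = .pend msg ∧ msg ∉ E.mem τ' := by
  induction τ with
  | zero => rw [E.mem_zero] at h; exact h.elim
  | succ τ ih =>
    by_cases hmem : msg ∈ E.mem τ
    · obtain ⟨τ', hτ', h'⟩ := ih hmem
      exact ⟨τ', hτ'.trans τ.lt_succ_self, h'⟩
    refine ⟨τ, τ.lt_succ_self, ?_, hmem⟩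
    have hstep := E.step τ
    generalize E.mem (τ + 1) = S' at h hstep
    generalize E.st (τ + 1) (σ τ) = s' at hstep
    cases hstep with
    | react | idle => exact absurd h hmem
    | write hm => exact hm.trans (congrArg _ (h.resolve_right hmem).symm)

theorem exists_issues_of_mem {msg : Msg n W} (h : msg ∈ E.mem τ) :
    ∃ τ' < τ, E.Issues τ' msg := by
  obtain ⟨τ₁, hτ₁, hpend, -⟩ := exists_pend_of_mem h
  obtain ⟨τ', hτ', h'⟩ := exists_issues_of_pend hpend
  exact ⟨τ', hτ'.trans hτ₁, h'⟩

namespace Issues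

variable {msg : Msg n W} {e : Fin n × ℕ} {r : ℕ} {h : History n} {w : W} {b : Bool}

theorem move_or_leave (hi : E.Issues τ msg) :
    (∃ t, (E.st τ (σ τ)).mode = .ready ∧ Move I (E.st τ (σ τ)).cur (E.st τ (σ τ)).hist (E.mem τ)
        ((E.st τ (σ τ)).slot (E.st τ (σ τ)).cur) t (some msg) ∧
          (E.st (τ + 1) (σ τ)).slot (E.st τ (σ τ)).cur = t) ∨
      ∃ e r w b, msg = .leave e r (E.st τ (σ τ)).hist w b ∧
        (E.st τ (σ τ)).mode = .inside e r w ∧ (b = true ↔ ∀ h u, .leave e r h u true ∉ E.mem τ) ∧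
        (E.st (τ + 1) (σ τ)).hist = (E.st τ (σ τ)).hist ++ [(e, r, b)] := by
  obtain ⟨hr, hmsg⟩ := hi
  generalize E.st (τ + 1) (σ τ) = s' at hr hmsg
  cases hr with
  | halt => cases hmsg
  | move hm _ hmove =>
    obtain rfl := Mode.after_eq_pend hmsg
    exact .inl ⟨_, hm, hmove, Function.update_self ..⟩
  | leave hm hb =>
    cases hmsg
    exact .inr ⟨_, _, _, _, rfl, hm, hb, rfl⟩

theorem of_enter (hi : E.Issues τ (.enter e r h w)) :
    (E.st τ (σ τ)).slot e.1 = ⟨e.2, r, .start, w⟩ ∧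
      ((E.st (τ + 1) (σ τ)).slot e.1).phase = .waiting := by
  rcases hi.move_or_leave with ⟨t, -, hmove, ht⟩ | ⟨_, _, _, _, hmsg, -⟩
  · generalize (E.st τ (σ τ)).cur = j at hmove ht
    generalize hs : (E.st τ (σ τ)).slot j = s at hmove
    cases hmove with
    | enter hp => exact ⟨by rw [hs, ← hp], congrArg Slot.phase ht⟩
  · cases hmsg

theorem of_leave (hi : E.Issues τ (.leave e r h w b)) :
    .enter e r h w ∈ E.mem τ ∧ (b = true ↔ ∀ h u, .leave e r h u true ∉ E.mem τ) ∧
      (E.st (τ + 1) (σ τ)).hist = h ++ [(e, r, b)] := by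
  rcases hi.move_or_leave with ⟨t, -, hmove, -⟩ | ⟨_, _, _, _, hmsg, hm, hb, hh⟩
  · cases hmove
  · cases hmsg
    exact ⟨(E.backed τ (σ τ)).enter_of_inside hm, hb, hh⟩

theorem of_propose (hi : E.Issues τ (.propose e r w)) :
    ∃ hs : Settled (E.mem τ) e r, w = hs.1.some := by
  rcases hi.move_or_leave with ⟨t, -, hmove, -⟩ | ⟨_, _, _, _, hmsg, -⟩
  · cases hmove with
    | propose _ _ hs => exact ⟨hs, rfl⟩
  · cases hmsg

theorem of_vote (hi : E.Issues τ (.vote e r b w)) :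
    .propose e r w ∈ E.mem τ ∧ (b = true ↔ ∀ u, .propose e r u ∈ E.mem τ → u = w) := by
  rcases hi.move_or_leave with ⟨t, hm, hmove, -⟩ | ⟨_, _, _, _, hmsg, -⟩
  · have hback := E.backed_of_ready hm (E.st τ (σ τ)).cur
    cases hmove with
    | vote hp _ hb =>
      simp only [Slot.Backed, hp] at hback
      exact ⟨hback, hb⟩
  · cases hmsg

theorem of_dec (hi : E.Issues τ (.dec e w)) :
    ∃ r, (∃ b, .vote e r b w ∈ E.mem τ) ∧ ∀ b u, .vote e r b u ∈ E.mem τ → b = true ∧ u = w := by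
  rcases hi.move_or_leave with ⟨t, hm, hmove, -⟩ | ⟨_, _, _, _, hmsg, -⟩
  · have hback := E.backed_of_ready hm (E.st τ (σ τ)).cur
    cases hmove with
    | commit hp _ hv =>
      simp only [Slot.Backed, hp] at hback
      exact ⟨_, hback, hv⟩
  · cases hmsg

end Issues

end Exec

/-! ### Agreement and validity -/

namespace Exec

variable {n m : ℕ} {A B W : Type u} [NeZero n] {I : ChainSpec n A B W} {x : Fin m → A}
  {σ : ℕ → Fin m} {E : Exec I x σ} {τ τ' : ℕ} {e : Fin n × ℕ} {r : ℕ} {w w' : W}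

theorem vote_true_unique (h : .vote e r true w ∈ E.mem τ) (h' : .vote e r true w' ∈ E.mem τ') :
    w = w' := by
  obtain ⟨τ₁, -, h₁⟩ := exists_issues_of_mem h
  obtain ⟨τ₂, -, h₂⟩ := exists_issues_of_mem h'
  rcases le_total τ₁ τ₂ with hle | hle
  · exact h₂.of_vote.2.mp rfl w (E.mem_mono hle h₁.of_vote.1)
  · exact (h₁.of_vote.2.mp rfl w' (E.mem_mono hle h₂.of_vote.1)).symm

variable (E) in
/-- Before time `τ` some simulator was at the start of round `r` of instance `e` with value `w`. -/
def Started (τ : ℕ) (e : Fin n × ℕ) (r : ℕ) (w : W) : Prop :=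
  ∃ τ' < τ, ∃ p, (E.st τ' p).slot e.1 = ⟨e.2, r, .start, w⟩

theorem Started.mono (h : E.Started τ e r w) (hle : τ ≤ τ') : E.Started τ' e r w :=
  let ⟨τ₀, hτ₀, hp⟩ := h
  ⟨τ₀, hτ₀.trans_le hle, hp⟩

theorem started_of_enter {h : History n} (hmem : .enter e r h w ∈ E.mem τ) :
    E.Started τ e r w := by
  obtain ⟨τ', hτ', hi⟩ := exists_issues_of_mem hmem
  exact ⟨τ', hτ', _, hi.of_enter.1⟩

theorem started_of_leave {h : History n} {b : Bool} (hmem : .leave e r h w b ∈ E.mem τ) :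
    E.Started τ e r w := by
  obtain ⟨τ', hτ', hi⟩ := exists_issues_of_mem hmem
  exact (started_of_enter hi.of_leave.1).mono hτ'.le

theorem started_of_propose (hmem : .propose e r w ∈ E.mem τ) : E.Started τ e r w := by
  obtain ⟨τ', hτ', hi⟩ := exists_issues_of_mem hmem
  obtain ⟨hs, rfl⟩ := hi.of_propose
  obtain ⟨h, hh⟩ := hs.1.some_mem
  exact (started_of_leave hh).mono hτ'.le

theorem started_of_vote {b : Bool} (hmem : .vote e r b w ∈ E.mem τ) : E.Started τ e r w := by
  obtain ⟨τ', hτ', hi⟩ := exists_issues_of_mem hmem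
  exact (started_of_propose hi.of_vote.1).mono hτ'.le

theorem exists_started_of_dec (hmem : .dec e w ∈ E.mem τ) : ∃ r, E.Started τ e r w := by
  obtain ⟨τ', hτ', hi⟩ := exists_issues_of_mem hmem
  obtain ⟨r, ⟨b, hb⟩, -⟩ := hi.of_dec
  exact ⟨r, (started_of_vote hb).mono hτ'.le⟩

theorem slot_eq_or_move (E : Exec I x σ) (τ : ℕ) (p : Fin m) (j : Fin n) :
    (E.st (τ + 1) p).slot j = (E.st τ p).slot j ∨
      p = σ τ ∧ (E.st τ p).mode = .ready ∧ (E.st τ p).cur = j ∧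
        ∃ o, Move I j (E.st τ p).hist (E.mem τ) ((E.st τ p).slot j) ((E.st (τ + 1) p).slot j) o ∧
          (E.st (τ + 1) p).mode = .after o := by
  by_cases hp : p = σ τ
  · subst hp
    exact ((E.step τ).slot_eq_or_move j).imp_right fun h => ⟨rfl, h⟩
  · exact .inl (by rw [E.other τ p hp])

theorem exists_move_of_slot_eq {p : Fin m} {j : Fin n} {s : Slot W}
    (hs : (E.st τ p).slot j = s) :
    s = ⟨0, 0, .start, I.init j (x p)⟩ ∨ ∃ τ' < τ, p = σ τ' ∧ (E.st τ' p).mode = .ready ∧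
      (E.st τ' p).cur = j ∧
        ∃ o, Move I j (E.st τ' p).hist (E.mem τ') ((E.st τ' p).slot j) s o := by
  induction τ with
  | zero => exact .inl (by rw [← hs, E.st_zero])
  | succ τ ih =>
    rcases E.slot_eq_or_move τ p j with heq | ⟨hp, hm, hj, o, hmove, -⟩
    · refine (ih (heq ▸ hs)).imp_right ?_
      rintro ⟨τ', hτ', h⟩
      exact ⟨τ', hτ'.trans τ.lt_succ_self, h⟩
    · exact .inr ⟨τ, τ.lt_succ_self, hp, hm, hj, o, hs ▸ hmove⟩

theorem Started.exists_vote (h : E.Started τ e (r + 1) w) :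
    ∃ τ' < τ, (∃ b, .vote e r b w ∈ E.mem τ') ∧
      (.vote e r true w ∈ E.mem τ' ∨ ∀ u, .vote e r true u ∉ E.mem τ') := by
  obtain ⟨τ₁, hτ₁, p, hs⟩ := h
  obtain ⟨j, k⟩ := e
  rcases exists_move_of_slot_eq (j := j) hs with h0 | ⟨τ', hτ', rfl, hm, -, o, hmove⟩
  · cases h0
  refine ⟨τ', hτ'.trans hτ₁, ?_⟩
  have hback := E.backed_of_ready hm j
  generalize (E.st τ' (σ τ')).slot j = s at hmove hback
  obtain ⟨i, r', phase, v⟩ := s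
  cases hmove with
  | wait hp | commit hp => cases hp
  | retry hp _ _ hw =>
    obtain rfl : phase = .voted := hp
    rcases hw with hw | ⟨hnot, rfl⟩
    exacts [⟨⟨true, hw⟩, .inl hw⟩, ⟨hback, .inr hnot⟩]

/-- Two simulators that read the votes of a round, one finding them unanimous and the other
starting the next round, cannot miss each other's votes: the later of them sees both. -/
theorem Started.eq_of_unanimous {b : Bool} (hw : .vote e r b w ∈ E.mem τ')
    (hall : ∀ b u, .vote e r b u ∈ E.mem τ' → b = true ∧ u = w) {i : ℕ}
    (h : E.Started τ e (r + i + 1) w') : w' = w := by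
  induction i generalizing τ with
  | zero =>
    obtain ⟨τ₁, -, ⟨b', hb'⟩, htrue | hnot⟩ := h.exists_vote
    · exact vote_true_unique htrue ((hall _ _ hw).1 ▸ hw)
    rcases le_total τ' τ₁ with hle | hle
    · exact absurd (E.mem_mono hle ((hall _ _ hw).1 ▸ hw)) (hnot w)
    · exact (hall _ _ (E.mem_mono hle hb')).2
  | succ i ih =>
    obtain ⟨τ₁, -, ⟨b', hb'⟩, -⟩ := h.exists_vote
    exact ih (started_of_vote hb')

theorem dec_unique (h : .dec e w ∈ E.mem τ) (h' : .dec e w' ∈ E.mem τ') : w = w' := by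
  obtain ⟨τ₁, -, h₁⟩ := exists_issues_of_mem h
  obtain ⟨τ₂, -, h₂⟩ := exists_issues_of_mem h'
  obtain ⟨r₁, ⟨b₁, hw₁⟩, hall₁⟩ := h₁.of_dec
  obtain ⟨r₂, ⟨b₂, hw₂⟩, hall₂⟩ := h₂.of_dec
  rcases lt_trichotomy r₁ r₂ with hlt | rfl | hlt
  · obtain ⟨i, rfl⟩ := Nat.exists_eq_add_of_lt hlt
    exact ((started_of_vote hw₂).eq_of_unanimous hw₁ hall₁).symm
  · exact vote_true_unique ((hall₁ _ _ hw₁).1 ▸ hw₁) ((hall₂ _ _ hw₂).1 ▸ hw₂)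
  · obtain ⟨i, rfl⟩ := Nat.exists_eq_add_of_lt hlt
    exact (started_of_vote hw₁).eq_of_unanimous hw₂ hall₂

variable (E) in
/-- The value `w` is a legitimate proposal for the instance `e` at time `τ`: value number `0` of a
chain comes from an input, every other one is computed from its predecessor and a read. -/
inductive Candidate (τ : ℕ) : Fin n × ℕ → W → Prop
  | init (j : Fin n) (p : Fin m) : Candidate τ (j, 0) (I.init j (x p))
  | next {τ' k : ℕ} {w : W} (hτ' : τ' < τ) (hm : (E.st τ' (σ τ')).mode = .ready)
      (hd : .dec ((E.st τ' (σ τ')).cur, k) w ∈ E.mem τ') :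
      Candidate τ ((E.st τ' (σ τ')).cur, k + 1) (I.next (E.st τ' (σ τ')).cur w (E.mem τ'))

theorem Candidate.mono (h : E.Candidate τ e w) (hle : τ ≤ τ') : E.Candidate τ' e w := by
  cases h with
  | init j p => exact .init j p
  | next hτ₀ hm hd => exact .next (hτ₀.trans_le hle) hm hd

theorem Started.candidate (h : E.Started τ e r w) : E.Candidate τ e w := by
  induction r generalizing τ with
  | zero =>
    obtain ⟨τ₁, hτ₁, p, hs⟩ := h
    obtain ⟨j, k⟩ := e
    rcases exists_move_of_slot_eq (j := j) hs with h0 | ⟨τ', hτ', rfl, hm, rfl, o, hmove⟩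
    · cases h0
      exact .init j p
    generalize (E.st τ' (σ τ')).slot _ = s at hmove
    obtain ⟨i, r', phase, v⟩ := s
    cases hmove with
    | advance hw => exact .next (hτ'.trans hτ₁) hm hw
    | wait hp | commit hp => cases hp
  | succ r ih =>
    obtain ⟨τ', hτ', ⟨b, hb⟩, -⟩ := h.exists_vote
    exact (ih (started_of_vote hb)).mono hτ'.le

theorem candidate_of_dec (h : .dec e w ∈ E.mem τ) : E.Candidate τ e w :=
  (exists_started_of_dec h).elim fun _ hr => hr.candidate

theorem dec_of_le {j : Fin n} {k k' : ℕ} (hle : k' ≤ k) (h : .dec (j, k) w ∈ E.mem τ) :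
    ∃ w', .dec (j, k') w' ∈ E.mem τ := by
  induction k, hle using Nat.le_induction generalizing w with
  | base => exact ⟨w, h⟩
  | succ k _ ih =>
    generalize he : (j, k + 1) = e at h
    cases candidate_of_dec h with
    | init => cases he
    | next hτ' _ hd =>
      cases he
      exact ih (E.mem_mono hτ'.le hd)

end Exec

/-! ### Rounds without a split -/

theorem eq_and_eq_of_branch {α : Type*} {u v l l' : List α} {a b a' b' : α}
    (hu : l ++ [a] <+: u) (hv : l ++ [b] <+: v) (hu' : l' ++ [a'] <+: u) (hv' : l' ++ [b'] <+: v)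
    (hab : a ≠ b) (hab' : a' ≠ b') : l = l' ∧ a = a' := by
  have length_le {l l' : List α} {a b a' b' : α} (hu : l ++ [a] <+: u) (hv : l ++ [b] <+: v)
      (hu' : l' ++ [a'] <+: u) (hv' : l' ++ [b'] <+: v) (hab : a ≠ b) :
      l'.length ≤ l.length := by
    by_contra! hlt
    have ha : l ++ [a] <+: l' :=
      List.prefix_of_prefix_length_le hu ((List.prefix_append ..).trans hu') (by simpa using hlt)
    have hb : l ++ [b] <+: l' :=
      List.prefix_of_prefix_length_le hv ((List.prefix_append ..).trans hv') (by simpa using hlt)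
    have heq : l ++ [a] = l ++ [b] :=
      (List.prefix_of_prefix_length_le ha hb (by simp)).eq_of_length (by simp)
    exact hab (by simpa using heq)
  have hlen : l.length = l'.length :=
    (length_le hu' hv' hu hv hab').antisymm (length_le hu hv hu' hv' hab)
  have heq : l ++ [a] = l' ++ [a'] :=
    (List.prefix_of_prefix_length_le hu hu' (by simp [hlen])).eq_of_length (by simp [hlen])
  simpa using heq

theorem Step.hist_prefix {n : ℕ} {A B W : Type u} [NeZero n] {I : ChainSpec n A B W}
    {S S' : Set (Msg n W)} {s s' : SimState n W B} (h : Step I S s S' s') : s.hist <+: s'.hist := by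
  cases h with
  | react h =>
    cases h with
    | halt | move => exact List.prefix_rfl
    | leave => exact List.prefix_append ..
  | write | idle => exact List.prefix_rfl

namespace Exec

variable {n m : ℕ} {A B W : Type u} [NeZero n] {I : ChainSpec n A B W} {x : Fin m → A}
  {σ : ℕ → Fin m} {E : Exec I x σ} {τ τ' : ℕ} {e : Fin n × ℕ} {r : ℕ} {w w' : W}

theorem hist_prefix (E : Exec I x σ) (p : Fin m) (hle : τ ≤ τ') :
    (E.st τ p).hist <+: (E.st τ' p).hist := by
  induction τ', hle using Nat.le_induction with
  | base => exact List.prefix_rfl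
  | succ τ' _ ih =>
    by_cases hp : p = σ τ'
    · exact ih.trans (hp ▸ (E.step τ').hist_prefix)
    · exact E.other τ' p hp ▸ ih

theorem exists_hist_of_leave {h : History n} {b : Bool} (hmem : .leave e r h w b ∈ E.mem τ) :
    ∃ p τ', h ++ [(e, r, b)] <+: (E.st τ' p).hist := by
  obtain ⟨τ', -, hi⟩ := exists_issues_of_mem hmem
  exact ⟨σ τ', τ' + 1, hi.of_leave.2.2 ▸ List.prefix_rfl⟩

variable (E) in
/-- Two simulators with the same history and value, hence indistinguishable by their messages, have
left round `r` of instance `e` with different flags. -/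
def Split (e : Fin n × ℕ) (r : ℕ) : Prop :=
  ∃ τ h w, .leave e r h w true ∈ E.mem τ ∧ .leave e r h w false ∈ E.mem τ

/-- After a split the histories of the two simulators involved differ for good. Hence every pair
of simulators splits at most once, and an instance has only finitely many rounds with a split. -/
theorem exists_not_split (E : Exec I x σ) (e : Fin n × ℕ) : ∃ r, ¬ E.Split e r := by
  by_contra! hall
  have hbranch (r : ℕ) : ∃ (pq : Fin m × Fin m) (h : History n) (τ : ℕ),
      h ++ [(e, r, true)] <+: (E.st τ pq.1).hist ∧ h ++ [(e, r, false)] <+: (E.st τ pq.2).hist := by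
    obtain ⟨_, h, _, htrue, hfalse⟩ := hall r
    obtain ⟨p, τ₁, hp⟩ := exists_hist_of_leave htrue
    obtain ⟨q, τ₂, hq⟩ := exists_hist_of_leave hfalse
    exact ⟨(p, q), h, max τ₁ τ₂, hp.trans (E.hist_prefix p (le_max_left _ _)),
      hq.trans (E.hist_prefix q (le_max_right _ _))⟩
  choose pq h τ htrue hfalse using hbranch
  obtain ⟨r, r', hne, hpq⟩ := Finite.exists_ne_map_eq_of_infinite pq
  have hle := le_max_left (τ r) (τ r')
  have hle' := le_max_right (τ r) (τ r')
  have heq := eq_and_eq_of_branch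
    ((htrue r).trans (E.hist_prefix _ hle)) ((hfalse r).trans (E.hist_prefix _ hle))
    (hpq ▸ (htrue r').trans (E.hist_prefix _ hle')) (hpq ▸ (hfalse r').trans (E.hist_prefix _ hle'))
    (by simp) (by simp)
  exact hne (by simpa using heq.2)

theorem winners_subset_of_not_split (hns : ¬ E.Split e r) (hs : Settled (E.mem τ) e r) :
    winners (E.mem τ') e r ⊆ winners (E.mem τ) e r := by
  rintro w ⟨h, hw⟩
  obtain ⟨τ₁, -, hi⟩ := exists_issues_of_mem hw
  obtain ⟨henter, hb, -⟩ := hi.of_leave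
  have hlt : τ₁ < τ := by
    by_contra! hle
    obtain ⟨u, h', hu⟩ := hs.1
    exact hb.mp rfl h' u (E.mem_mono hle hu)
  obtain ⟨b, hleave⟩ := hs.2 h w (E.mem_mono hlt.le henter)
  cases b with
  | true => exact ⟨h, hleave⟩
  | false =>
    exact absurd ⟨max τ τ', h, w, E.mem_mono (le_max_right _ _) hw,
      E.mem_mono (le_max_left _ _) hleave⟩ hns

theorem propose_unique (hns : ¬ E.Split e r) (h : .propose e r w ∈ E.mem τ)
    (h' : .propose e r w' ∈ E.mem τ') : w = w' := by
  obtain ⟨τ₁, -, h₁⟩ := exists_issues_of_mem h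
  obtain ⟨τ₂, -, h₂⟩ := exists_issues_of_mem h'
  obtain ⟨hs₁, rfl⟩ := h₁.of_propose
  obtain ⟨hs₂, rfl⟩ := h₂.of_propose
  congr 1
  exact (winners_subset_of_not_split hns hs₂).antisymm (winners_subset_of_not_split hns hs₁)

theorem vote_unanimous (hns : ¬ E.Split e r) {b b' : Bool} (h : .vote e r b w ∈ E.mem τ)
    (h' : .vote e r b' w' ∈ E.mem τ') : b' = true ∧ w' = w := by
  obtain ⟨τ₁, -, h₁⟩ := exists_issues_of_mem h
  obtain ⟨τ₂, -, h₂⟩ := exists_issues_of_mem h'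
  exact ⟨h₂.of_vote.2.mpr fun u hu => propose_unique hns hu h₂.of_vote.1,
    propose_unique hns h₂.of_vote.1 h₁.of_vote.1⟩

theorem round_le_of_not_split {j : Fin n} {k : ℕ} (hns : ¬ E.Split (j, k) r) {p : Fin m}
    (hk : ((E.st τ p).slot j).idx = k) : ((E.st τ p).slot j).round ≤ r := by
  induction τ with
  | zero => simp [E.st_zero]
  | succ τ ih =>
    rcases E.slot_eq_or_move τ p j with heq | ⟨-, hm, -, o, hmove, -⟩
    · rw [heq] at hk ⊢
      exact ih hk
    have hback := E.backed_of_ready hm j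
    generalize (E.st τ p).slot j = s at hmove hback ih
    generalize (E.st (τ + 1) p).slot j = s' at hmove hk
    cases hmove with
    | advance => exact Nat.zero_le _
    | enter | wait | propose | vote | commit => exact ih hk
    | retry hp _ hv =>
      subst hk
      simp only [Slot.Backed, hp] at hback
      obtain ⟨b, hb⟩ := hback
      refine Nat.succ_le_of_lt ((ih rfl).lt_of_ne ?_)
      rintro rfl
      exact hv fun _ _ hu => vote_unanimous hns hb hu

variable (E) in
/-- Sooner or later a value is agreed upon in the instance `e`. -/
def Decided (e : Fin n × ℕ) : Prop :=
  ∃ τ w, .dec e w ∈ E.mem τ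

theorem idx_le_of_not_decided {j : Fin n} {k : ℕ} (hu : ¬ E.Decided (j, k)) (τ : ℕ) (p : Fin m) :
    ((E.st τ p).slot j).idx ≤ k := by
  induction τ with
  | zero => simp [E.st_zero]
  | succ τ ih =>
    rcases E.slot_eq_or_move τ p j with heq | ⟨-, -, -, o, hmove, -⟩
    · rwa [heq]
    generalize (E.st τ p).slot j = s at hmove ih
    generalize (E.st (τ + 1) p).slot j = s' at hmove
    cases hmove with
    | advance hw =>
      refine Nat.succ_le_of_lt (ih.lt_of_ne ?_)
      rintro rfl
      exact hu ⟨_, _, hw⟩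
    | _ => exact ih

end Exec

/-! ### Progress -/

theorem eventually_eq_of_rank_lt {α : Type*} {f : ℕ → α} {rank : α → ℕ} {C : ℕ}
    (hstep : ∀ τ, f (τ + 1) = f τ ∨ rank (f τ) < rank (f (τ + 1))) (hC : ∀ τ, rank (f τ) ≤ C) :
    ∀ᶠ τ in Filter.atTop, f (τ + 1) = f τ := by
  have hmono : Monotone fun τ => rank (f τ) :=
    monotone_nat_of_le_succ fun τ => (hstep τ).elim (fun h => by rw [h]) le_of_lt
  have hbdd : BddAbove (Set.range fun τ => rank (f τ)) := ⟨C, Set.forall_mem_range.mpr hC⟩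
  obtain ⟨τ₀, hτ₀⟩ := Nat.sSup_mem (Set.range_nonempty _) hbdd
  filter_upwards [Filter.eventually_ge_atTop τ₀] with τ hτ
  have hmax : rank (f (τ + 1)) ≤ rank (f τ₀) :=
    (le_csSup hbdd ⟨τ + 1, rfl⟩).trans_eq hτ₀.symm
  exact (hstep τ).resolve_right (hmax.trans (hmono hτ)).not_gt

/-- The number of a phase in the order in which a round passes through them. -/
def Phase.rank : Phase → ℕ
  | .start => 0
  | .waiting => 1
  | .proposed => 2
  | .voted => 3

/-- A measure of progress for slots, valid as long as no round number exceeds `R`. -/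
def Slot.rank {W : Type u} (R : ℕ) (s : Slot W) : ℕ :=
  (s.idx * (R + 1) + s.round) * 4 + s.phase.rank

theorem Phase.rank_le (φ : Phase) : φ.rank ≤ 3 := by
  cases φ <;> decide

theorem Slot.rank_le {W : Type u} {R k : ℕ} {s : Slot W} (hk : s.idx ≤ k) (hR : s.round ≤ R) :
    s.rank R ≤ (k * (R + 1) + R) * 4 + 3 := by
  unfold Slot.rank
  gcongr
  exact s.phase.rank_le

namespace Move

variable {n : ℕ} {A B W : Type u} {I : ChainSpec n A B W} {j : Fin n} {h : History n}
  {S : Set (Msg n W)} {s s' : Slot W} {o : Option (Msg n W)}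

theorem eq_or_rank_lt {R : ℕ} (hmove : Move I j h S s s' o) (hR : s.round ≤ R) :
    s' = s ∨ s.rank R < s'.rank R := by
  have := s.phase.rank_le
  cases hmove with
  | wait | commit => exact .inl rfl
  | advance =>
    refine .inr ?_
    simp only [Slot.rank, Phase.rank, Nat.succ_mul]
    lia
  | enter hp | propose hp | vote hp | retry hp =>
    refine .inr ?_
    simp only [Slot.rank, Phase.rank, hp]
    lia

theorem waits_or_commits_of_eq (hmove : Move I j h S s s' o) (heq : s' = s) :
    (s.phase = .waiting ∧ ¬ Settled S (j, s.idx) s.round) ∨ o = some (.dec (j, s.idx) s.val) := by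
  cases hmove with
  | wait hp _ hs => exact .inl ⟨hp, hs⟩
  | commit => exact .inr rfl
  | advance => exact absurd (congrArg Slot.idx heq) (Nat.succ_ne_self _)
  | retry => exact absurd (congrArg Slot.round heq) (Nat.succ_ne_self _)
  | enter hp | propose hp | vote hp => cases (congrArg Slot.phase heq).trans hp

theorem ne_of_dec (hmove : Move I j h S s s' o) {w : W} (hw : .dec (j, s.idx) w ∈ S) :
    s' ≠ s := by
  intro heq
  cases hmove with
  | advance => exact absurd (congrArg Slot.idx heq) (Nat.succ_ne_self _)
  | wait _ hu | commit _ hu | enter _ hu | propose _ hu | vote _ hu | retry _ hu => exact hu w hw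

end Move

/-- A simulator in this mode is inside the gate of some round of the instance `e`. -/
def Mode.Occupies {n : ℕ} {W B : Type u} (e : Fin n × ℕ) : Mode n W B → Prop
  | .inside e' _ _ => e' = e
  | .pend (.leave e' _ _ _ _) => e' = e
  | _ => False

theorem Mode.Occupies.unique {n : ℕ} {W B : Type u} {e e' : Fin n × ℕ} {μ : Mode n W B}
    (h : μ.Occupies e) (h' : μ.Occupies e') : e = e' := by
  unfold Mode.Occupies at h h'
  split at h
  · exact h.symm.trans h'
  · exact h.symm.trans h'
  · exact h.elim

namespace Exec

variable {n m : ℕ} {A B W : Type u} [NeZero n] {I : ChainSpec n A B W} {x : Fin m → A}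
  {σ : ℕ → Fin m} {E : Exec I x σ} {τ : ℕ} {e : Fin n × ℕ} {p : Fin m}

variable (E) in
/-- No simulator ever halts. -/
def Nonhalting : Prop :=
  ∀ τ p b, (E.st τ p).mode ≠ .done b

variable (E) in
/-- The simulator `p` crashes inside a gate of the instance `e`. -/
def Blocks (p : Fin m) (e : Fin n × ℕ) : Prop :=
  Faulty σ p ∧ ∀ᶠ τ in Filter.atTop, (E.st τ p).mode.Occupies e

theorem Blocks.unique {e' : Fin n × ℕ} (h : E.Blocks p e) (h' : E.Blocks p e') : e = e' :=
  let ⟨_, hτ, hτ'⟩ := (h.2.and h'.2).exists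
  hτ.unique hτ'

theorem exists_next_step (E : Exec I x σ) (hp : ¬ Faulty σ p) (τ : ℕ) :
    ∃ τ' ≥ τ, σ τ' = p ∧ E.st τ' p = E.st τ p := by
  classical
  have hex : ∃ d, σ (τ + d) = p := by
    obtain ⟨τ', hτ', hlt⟩ := (show {τ' | σ τ' = p}.Infinite from hp).exists_gt τ
    exact ⟨τ' - τ, by rwa [Nat.add_sub_cancel' hlt.le]⟩
  refine ⟨τ + Nat.find hex, Nat.le_add_right _ _, Nat.find_spec hex, ?_⟩
  have hst (d : ℕ) (hd : d ≤ Nat.find hex) : E.st (τ + d) p = E.st τ p := by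
    induction d with
    | zero => rfl
    | succ d ih =>
      rw [← ih (Nat.le_of_succ_le hd)]
      exact E.other _ _ (Ne.symm (Nat.find_min hex hd))
  exact hst _ le_rfl

theorem exists_write_of_pend (hp : ¬ Faulty σ p) {msg : Msg n W}
    (hm : (E.st τ p).mode = .pend msg) :
    ∃ τ' > τ, msg ∈ E.mem τ' ∧ E.st τ' p = { E.st τ p with mode := msg.resume } := by
  obtain ⟨τ', hle, rfl, hst⟩ := E.exists_next_step hp τ
  obtain ⟨hS, hs⟩ := (E.step τ').of_pend (hst ▸ hm)
  exact ⟨τ' + 1, Nat.lt_succ_of_le hle, hS ▸ Set.mem_insert _ _, by rw [hs, hst]⟩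

theorem exists_leave_of_inside (hp : ¬ Faulty σ p) {r : ℕ} {w : W}
    (hm : (E.st τ p).mode = .inside e r w) :
    ∃ τ' > τ, ∃ b, (E.st τ' p).turn = (E.st τ p).turn ∧
      (E.st τ' p).mode = .pend (.leave e r (E.st τ p).hist w b) := by
  obtain ⟨τ', hle, rfl, hst⟩ := E.exists_next_step hp τ
  obtain ⟨-, b, -, hs⟩ := (E.step τ').of_inside (hst ▸ hm)
  exact ⟨τ' + 1, Nat.lt_succ_of_le hle, b, by rw [hs, hst], by rw [hs, hst]⟩

theorem blocks_of_forall_not_leave {r : ℕ} {h : History n} {w : W}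
    (hmem : .enter e r h w ∈ E.mem τ) (hnot : ∀ τ b, .leave e r h w b ∉ E.mem τ) :
    ∃ q, E.Blocks q e := by
  obtain ⟨τ₁, -, hpend, -⟩ := exists_pend_of_mem hmem
  obtain ⟨-, hs⟩ := (E.step τ₁).of_pend hpend
  obtain rfl := (E.backed _ _).hist_of_pend hpend
  set q := σ τ₁
  set h := (E.st τ₁ q).hist
  have hinv (τ) (hτ : τ₁ + 1 ≤ τ) : ((E.st τ q).mode = .inside e r w ∧ (E.st τ q).hist = h) ∨
      ∃ b, (E.st τ q).mode = .pend (.leave e r h w b) := by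
    induction τ, hτ using Nat.le_induction with
    | base => exact .inl (by rw [hs]; exact ⟨rfl, rfl⟩)
    | succ τ _ ih =>
      by_cases hq : q = σ τ
      · rw [hq] at ih ⊢
        rcases ih with ⟨hm, hh⟩ | ⟨b, hm⟩
        · obtain ⟨-, b, -, hs'⟩ := (E.step τ).of_inside hm
          exact .inr ⟨b, by rw [hs', hh]⟩
        · exact absurd ((E.step τ).of_pend hm).1 fun hS =>
            hnot (τ + 1) b (hS ▸ Set.mem_insert _ _)
      · rwa [E.other τ q hq]
  have not_pend (hq : ¬ Faulty σ q) (τ b) : (E.st τ q).mode ≠ .pend (.leave e r h w b) :=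
    fun hm => let ⟨τ', _, hw, _⟩ := exists_write_of_pend hq hm; hnot τ' b hw
  refine ⟨q, ?_, ?_⟩
  · by_contra hq
    obtain ⟨hm, hh⟩ := (hinv _ le_rfl).resolve_right fun ⟨b, hm⟩ => not_pend hq _ b hm
    obtain ⟨τ', -, b, -, hm'⟩ := exists_leave_of_inside hq hm
    exact not_pend hq τ' b (hh ▸ hm')
  · filter_upwards [Filter.eventually_ge_atTop (τ₁ + 1)] with τ hτ
    rcases hinv τ hτ with ⟨hm, -⟩ | ⟨b, hm⟩ <;> rw [hm] <;> exact rfl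

theorem exists_ready (hp : ¬ Faulty σ p) (hnh : ∀ τ b, (E.st τ p).mode ≠ .done b) (τ : ℕ) :
    ∃ τ' ≥ τ, σ τ' = p ∧ (E.st τ' p).mode = .ready ∧ (E.st τ' p).turn = (E.st τ p).turn := by
  have of_ready (τ) (hm : (E.st τ p).mode = .ready) : ∃ τ' ≥ τ, σ τ' = p ∧
      (E.st τ' p).mode = .ready ∧ (E.st τ' p).turn = (E.st τ p).turn := by
    obtain ⟨τ', hle, hσ, hst⟩ := E.exists_next_step hp τ
    exact ⟨τ', hle, hσ, hst ▸ hm, by rw [hst]⟩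
  have of_inside (τ) {e r w} (hm : (E.st τ p).mode = .inside e r w) : ∃ τ' ≥ τ, σ τ' = p ∧
      (E.st τ' p).mode = .ready ∧ (E.st τ' p).turn = (E.st τ p).turn := by
    obtain ⟨τ₁, hτ₁, b, hturn₁, hm₁⟩ := exists_leave_of_inside hp hm
    obtain ⟨τ₂, hτ₂, -, hs₂⟩ := exists_write_of_pend hp hm₁
    obtain ⟨τ', hτ', hσ, hm', hturn⟩ := of_ready τ₂ (by rw [hs₂]; rfl)
    exact ⟨τ', (hτ₁.trans hτ₂).le.trans hτ', hσ, hm', by rw [hturn, hs₂, hturn₁]⟩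
  cases hm : (E.st τ p).mode with
  | ready => exact of_ready τ hm
  | inside => exact of_inside τ hm
  | done b => exact absurd hm (hnh τ b)
  | pend msg =>
    obtain ⟨τ₁, hτ₁, -, hs₁⟩ := exists_write_of_pend hp hm
    have hgoal : ∃ τ' ≥ τ₁, σ τ' = p ∧ (E.st τ' p).mode = .ready ∧
        (E.st τ' p).turn = (E.st τ₁ p).turn := by
      cases msg with
      | enter => exact of_inside τ₁ (by rw [hs₁]; rfl)
      | _ => exact of_ready τ₁ (by rw [hs₁]; rfl)
    obtain ⟨τ', hτ', hσ, hm', hturn⟩ := hgoal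
    exact ⟨τ', hτ₁.le.trans hτ', hσ, hm', by rw [hturn, hs₁]⟩

theorem mode_eq_done_of_le {τ' : ℕ} {b : B} (hle : τ ≤ τ') (hm : (E.st τ p).mode = .done b) :
    (E.st τ' p).mode = .done b := by
  induction τ', hle using Nat.le_induction with
  | base => exact hm
  | succ τ' _ ih =>
    by_cases hp : p = σ τ'
    · subst hp
      rw [((E.step τ').of_done ih).2, ih]
    · rw [E.other τ' p hp, ih]

theorem exists_out_of_done {b : B} (hm : (E.st τ p).mode = .done b) :
    ∃ τ' < τ, I.out (E.mem τ') = some b := by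
  induction τ with
  | zero => rw [E.st_zero] at hm; cases hm
  | succ τ ih =>
    by_cases hp : p = σ τ
    · subst hp
      have hstep := E.step τ
      generalize E.mem (τ + 1) = S' at hstep
      generalize E.st (τ + 1) (σ τ) = s' at hm hstep
      cases hstep with
      | react hr =>
        cases hr with
        | halt _ ho => cases hm; exact ⟨τ, τ.lt_succ_self, ho⟩
        | @move _ o => cases o <;> cases hm
        | leave => cases hm
      | @write msg => cases msg <;> cases hm
      | idle => exact (ih hm).imp fun _ h => ⟨h.1.trans τ.lt_succ_self, h.2⟩
    · rw [E.other τ p hp] at hm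
      exact (ih hm).imp fun _ h => ⟨h.1.trans τ.lt_succ_self, h.2⟩

theorem exists_done (hp : ¬ Faulty σ p) (hout : ∀ τ' ≥ τ, I.out (E.mem τ') ≠ none) :
    ∃ τ' b, (E.st τ' p).mode = .done b := by
  by_contra! hnh
  obtain ⟨τ', hτ', rfl, hm, -⟩ := exists_ready hp hnh τ
  obtain ⟨-, ⟨b, -, hs⟩ | ⟨ho, -⟩⟩ := (E.step τ').of_ready hm
  · exact hnh (τ' + 1) b (by rw [hs])
  · exact hout τ' hτ' ho

variable (E) in
theorem exists_forall_done :
    ∃ T, ∀ τ p b, (E.st τ p).mode = .done b → (E.st T p).mode = .done b := by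
  have hev : ∀ᶠ T in Filter.atTop, ∀ p, ∀ τ b,
      (E.st τ p).mode = .done b → (E.st T p).mode = .done b := by
    rw [Filter.eventually_all]
    intro p
    by_cases h : ∃ τ b, (E.st τ p).mode = .done b
    · obtain ⟨τ₀, b₀, h₀⟩ := h
      filter_upwards [Filter.eventually_ge_atTop τ₀] with T hT τ b hb
      rw [mode_eq_done_of_le hT h₀, ← mode_eq_done_of_le (le_max_left τ₀ τ) h₀,
        mode_eq_done_of_le (le_max_right τ₀ τ) hb]
    · push Not at h
      exact .of_forall fun T τ b hb => absurd hb (h τ b)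
  obtain ⟨T, hT⟩ := hev.exists
  exact ⟨T, fun τ p => hT p τ⟩

theorem Nonhalting.exists_move (hnh : E.Nonhalting) (hm : (E.st τ (σ τ)).mode = .ready) :
    ∃ s o, Move I (E.st τ (σ τ)).cur (E.st τ (σ τ)).hist (E.mem τ)
        ((E.st τ (σ τ)).slot (E.st τ (σ τ)).cur) s o ∧
      E.st (τ + 1) (σ τ) = ⟨(E.st τ (σ τ)).turn + 1, (E.st τ (σ τ)).hist,
        Function.update (E.st τ (σ τ)).slot (E.st τ (σ τ)).cur s, .after o⟩ := by
  obtain ⟨-, ⟨b, -, hs⟩ | ⟨-, s, o, hmove, hs⟩⟩ := (E.step τ).of_ready hm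
  · exact absurd (by rw [hs]) (hnh (τ + 1) (σ τ) b)
  · exact ⟨s, o, hmove, hs⟩

theorem exists_visit (hp : ¬ Faulty σ p) (hnh : E.Nonhalting) (j : Fin n) (τ : ℕ) :
    ∃ τ' ≥ τ, σ τ' = p ∧ (E.st τ' p).mode = .ready ∧ (E.st τ' p).cur = j := by
  have hturn (d : ℕ) : ∃ τ' ≥ τ, σ τ' = p ∧ (E.st τ' p).mode = .ready ∧
      (E.st τ' p).turn = (E.st τ p).turn + d := by
    induction d with
    | zero => exact exists_ready hp (hnh · p) τ
    | succ d ih =>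
      obtain ⟨τ₁, hτ₁, rfl, hm₁, hturn₁⟩ := ih
      obtain ⟨s, o, -, hs⟩ := hnh.exists_move hm₁
      obtain ⟨τ', hτ', hσ, hm', hturn⟩ := exists_ready hp (hnh · _) (τ₁ + 1)
      exact ⟨τ', hτ₁.trans (τ₁.le_succ.trans hτ'), hσ, hm', by rw [hturn, hs, hturn₁, add_assoc]⟩
  obtain ⟨d, hd⟩ := Nat.exists_eq_add_of_le
    (le_add_right (Nat.le_mul_of_pos_left (E.st τ p).turn (NeZero.pos n)) (c := j.val))
  obtain ⟨τ', hτ', hσ, hm, ht⟩ := hturn d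
  refine ⟨τ', hτ', hσ, hm, Fin.ext ?_⟩
  rw [SimState.cur, ht, ← hd, Fin.val_ofNat, Nat.mul_add_mod, Nat.mod_eq_of_lt j.isLt]

end Exec

/-! ### Blocked agreement instances -/

theorem exists_not_faulty {m : ℕ} [NeZero m] (σ : ℕ → Fin m) : ∃ i, ¬ Faulty σ i := by
  obtain ⟨i, hi⟩ := Finite.exists_infinite_fiber σ
  exact ⟨i, fun h => h.not_infinite (Set.infinite_coe_iff.mp hi)⟩

namespace Exec

variable {n m : ℕ} {A B W : Type u} [NeZero n] {I : ChainSpec n A B W} {x : Fin m → A}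
  {σ : ℕ → Fin m} {E : Exec I x σ} {j : Fin n} {k : ℕ} {e : Fin n × ℕ}

theorem eventually_slot_eq (hu : ¬ E.Decided (j, k)) :
    ∀ᶠ τ in Filter.atTop, ∀ p, (E.st (τ + 1) p).slot j = (E.st τ p).slot j := by
  choose R hR using fun k => E.exists_not_split (j, k)
  set C := (Finset.range (k + 1)).sup R
  have round_le (τ p) : ((E.st τ p).slot j).round ≤ C :=
    (round_le_of_not_split (hR _) rfl).trans
      (Finset.le_sup (Finset.mem_range_succ_iff.mpr (idx_le_of_not_decided hu τ p)))
  refine Filter.eventually_all.mpr fun p =>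
    eventually_eq_of_rank_lt (f := fun τ => (E.st τ p).slot j) (rank := Slot.rank C)
      (fun τ => ?_) (fun τ => Slot.rank_le (idx_le_of_not_decided hu τ p) (round_le τ p))
  rcases E.slot_eq_or_move τ p j with heq | ⟨-, -, -, o, hmove, -⟩
  exacts [.inl heq, hmove.eq_or_rank_lt (round_le τ p)]

theorem finite_enter (hu : ¬ E.Decided e) :
    {d : ℕ × History n × W | ∃ τ, .enter e d.1 d.2.1 d.2.2 ∈ E.mem τ}.Finite := by
  obtain ⟨T, hT⟩ := Filter.eventually_atTop.mp (eventually_slot_eq hu)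
  refine Set.Finite.of_finite_image (f := fun d : ℕ × History n × W =>
    (.pend (.enter e d.1 d.2.1 d.2.2) : Mode n W B))
    (((Set.finite_Iio T).image fun τ => (E.st (τ + 1) (σ τ)).mode).subset ?_) ?_
  · rintro _ ⟨d, ⟨τ, hd⟩, rfl⟩
    obtain ⟨τ', -, hi⟩ := exists_issues_of_mem hd
    refine ⟨τ', ?_, hi.2⟩
    by_contra hle
    obtain ⟨hbefore, hafter⟩ := hi.of_enter
    rw [hT τ' (not_lt.mp hle), hbefore] at hafter
    cases hafter
  · rintro ⟨r, h, w⟩ - ⟨r', h', w'⟩ - heq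
    cases heq
    rfl

theorem eventually_leave (hu : ¬ E.Decided e) (hnb : ∀ q, ¬ E.Blocks q e) :
    ∀ᶠ τ in Filter.atTop, ∀ r h w, .enter e r h w ∈ E.mem τ → ∃ b, .leave e r h w b ∈ E.mem τ := by
  have hleave : ∀ᶠ τ in Filter.atTop,
      ∀ d ∈ {d : ℕ × History n × W | ∃ τ, .enter e d.1 d.2.1 d.2.2 ∈ E.mem τ},
        ∃ b, .leave e d.1 d.2.1 d.2.2 b ∈ E.mem τ := by
    rw [Filter.eventually_all_finite (finite_enter hu)]
    rintro d ⟨τ, hd⟩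
    obtain ⟨τ', b, hb⟩ : ∃ τ' b, .leave e d.1 d.2.1 d.2.2 b ∈ E.mem τ' := by
      by_contra! hnot
      obtain ⟨q, hq⟩ := blocks_of_forall_not_leave hd hnot
      exact hnb q hq
    filter_upwards [Filter.eventually_ge_atTop τ'] with τ'' hle
    exact ⟨b, E.mem_mono hle hb⟩
  filter_upwards [hleave] with τ hτ r h w henter
  exact hτ ⟨r, h, w⟩ ⟨τ, henter⟩

theorem settled_of_forall_leave {τ r : ℕ} {h : History n} {w : W}
    (henter : .enter e r h w ∈ E.mem τ)
    (hleave : ∀ h w, .enter e r h w ∈ E.mem τ → ∃ b, .leave e r h w b ∈ E.mem τ) :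
    Settled (E.mem τ) e r := by
  refine ⟨?_, hleave⟩
  obtain ⟨b, hb⟩ := hleave h w henter
  cases b with
  | true => exact ⟨w, h, hb⟩
  | false =>
    obtain ⟨τ', hτ', hi⟩ := exists_issues_of_mem hb
    obtain ⟨h', w', hw'⟩ : ∃ h u, .leave e r h u true ∈ E.mem τ' := by
      by_contra! hnot
      exact Bool.false_ne_true (hi.of_leave.2.1.mpr hnot)
    exact ⟨w', h', E.mem_mono hτ'.le hw'⟩

theorem exists_blocks {p : Fin m} (hp : ¬ Faulty σ p) (hnh : E.Nonhalting)
    (hu : ¬ E.Decided (j, k)) (hd : ∀ k' < k, E.Decided (j, k')) : ∃ q, E.Blocks q (j, k) := by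
  by_contra! hnb
  have hdec : ∀ᶠ τ in Filter.atTop, ∀ k' ∈ Set.Iio k, ∃ w, .dec (j, k') w ∈ E.mem τ := by
    rw [Filter.eventually_all_finite (Set.finite_Iio k)]
    intro k' hk'
    obtain ⟨τ', w, hw⟩ := hd k' hk'
    filter_upwards [Filter.eventually_ge_atTop τ'] with τ hle
    exact ⟨w, E.mem_mono hle hw⟩
  obtain ⟨T, hT⟩ := Filter.eventually_atTop.mp
    ((eventually_slot_eq hu).and ((eventually_leave hu hnb).and hdec))
  obtain ⟨τ, hτ, rfl, hm, rfl⟩ := exists_visit hp hnh j T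
  obtain ⟨hslot, hleave, hdec⟩ := hT τ hτ
  obtain ⟨s, o, hmove, hs⟩ := hnh.exists_move hm
  have heq : s = (E.st τ (σ τ)).slot (E.st τ (σ τ)).cur := by
    rw [← hslot (σ τ), hs]
    simp only [Function.update_self]
  have hidx : ((E.st τ (σ τ)).slot (E.st τ (σ τ)).cur).idx = k := by
    refine (idx_le_of_not_decided hu τ _).antisymm (not_lt.mp fun hlt => ?_)
    obtain ⟨w, hw⟩ := hdec _ hlt
    exact hmove.ne_of_dec hw heq
  rcases hmove.waits_or_commits_of_eq heq with ⟨hwait, hns⟩ | rfl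
  · have hback := E.backed_of_ready hm (E.st τ (σ τ)).cur
    simp only [Slot.Backed, hwait] at hback
    obtain ⟨h, henter⟩ := hback
    exact hns (settled_of_forall_leave henter (hidx ▸ hleave _))
  · obtain ⟨τ', -, hw, -⟩ := exists_write_of_pend (τ := τ + 1) hp (by rw [hs]; rfl)
    exact hu ⟨τ', _, hidx ▸ hw⟩

/-- A simulator crashes inside the gate of at most one instance, so it blocks at most one
simulated process. -/
theorem ncard_not_decided_le [NeZero m] (hnh : E.Nonhalting) :
    {j | ∃ k, ¬ E.Decided (j, k)}.ncard ≤ {p | Faulty σ p}.ncard := by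
  classical
  obtain ⟨p, hp⟩ := exists_not_faulty σ
  have hblock (j) (hj : ∃ k, ¬ E.Decided (j, k)) : ∃ q k, E.Blocks q (j, k) := by
    obtain ⟨q, hq⟩ := exists_blocks hp hnh (Nat.find_spec hj)
      fun k' hk' => not_not.mp (Nat.find_min hj hk')
    exact ⟨q, _, hq⟩
  choose! q k hq using hblock
  exact Set.ncard_le_ncard_of_injOn q (fun j hj => (hq j hj).1) fun j hj j' hj' h =>
    congrArg Prod.fst ((hq j hj).unique (h ▸ hq j' hj'))

end Exec

/-! ### Schedules with gaps -/

section

variable {n : ℕ} {s : ℕ → Option (Fin n)} (hs : {u | (s u).isSome}.Infinite)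

/-- The schedule that remains of `s` when the instants without a step are removed. -/
noncomputable def densify : ℕ → Fin n :=
  fun m => (s (Nat.nth (fun u => (s u).isSome) m)).get (Nat.nth_mem_of_infinite hs m)

theorem some_densify (m : ℕ) : some (densify hs m) = s (Nat.nth (fun u => (s u).isSome) m) :=
  Option.some_get _

theorem faulty_densify_iff {j : Fin n} : Faulty (densify hs) j ↔ {u | s u = some j}.Finite := by
  have himage : {u | s u = some j} =
      Nat.nth (fun u => (s u).isSome) '' {m | densify hs m = j} := by
    ext u
    constructor
    · intro hu
      have hnth : Nat.nth (fun u => (s u).isSome) (Nat.count (fun u => (s u).isSome) u) = u :=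
        Nat.nth_count (Option.isSome_of_mem hu)
      refine ⟨_, Option.some_injective _ ?_, hnth⟩
      rw [some_densify, hnth]
      exact hu
    · rintro ⟨m, hm, rfl⟩
      exact (some_densify hs m).symm.trans (congrArg some hm)
  rw [himage, Set.finite_image_iff (Nat.nth_injective hs).injOn]
  rfl

/-- The schedule that follows `s` before time `T` and then lets all processes take steps in
cyclic order. -/
def thenRoundRobin [NeZero n] (T : ℕ) (s : ℕ → Option (Fin n)) (u : ℕ) : Option (Fin n) :=
  if u < T then s u else some (Fin.ofNat n u)

theorem infinite_thenRoundRobin [NeZero n] (T : ℕ) (s : ℕ → Option (Fin n)) (j : Fin n) :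
    {u | thenRoundRobin T s u = some j}.Infinite := by
  refine Set.infinite_of_forall_exists_gt fun a => ⟨n * (a + T + 1) + j, ?_, ?_⟩
  all_goals have hle : a + T + 1 ≤ n * (a + T + 1) := Nat.le_mul_of_pos_left _ (NeZero.pos n)
  · have hj : Fin.ofNat n (n * (a + T + 1) + j) = j :=
      Fin.ext (by rw [Fin.val_ofNat, Nat.mul_add_mod, Nat.mod_eq_of_lt j.isLt])
    rw [Set.mem_ofPred_eq, thenRoundRobin, if_neg (by lia), hj]
  · lia

end

namespace SnapshotProtocol

section

variable {n : ℕ} {A B : Type u} (P : SnapshotProtocol n A B) (x : Fin n → A)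
  {s s' : ℕ → Option (Fin n)}

/-- The execution driven by a schedule in which no process takes a step at some instants. -/
noncomputable def sparseRun (s : ℕ → Option (Fin n)) : ℕ → P.Config
  | 0 => ⟨fun i => P.start i (x i), P.mem₀⟩
  | u + 1 => (s u).elim (sparseRun s u) (P.step (sparseRun s u))

theorem sparseRun_succ_of_none {u : ℕ} (h : s u = none) :
    P.sparseRun x s (u + 1) = P.sparseRun x s u := by
  rw [sparseRun, h, Option.elim_none]

theorem sparseRun_succ_of_some {u : ℕ} {j : Fin n} (h : s u = some j) :
    P.sparseRun x s (u + 1) = P.step (P.sparseRun x s u) j := by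
  rw [sparseRun, h, Option.elim_some]

theorem sparseRun_congr {u : ℕ} (h : ∀ v < u, s v = s' v) :
    P.sparseRun x s u = P.sparseRun x s' u := by
  induction u with
  | zero => rfl
  | succ u ih =>
    rw [sparseRun, sparseRun, h u u.lt_succ_self, ih fun v hv => h v (hv.trans u.lt_succ_self)]

theorem run_densify_count (hs : {u | (s u).isSome}.Infinite) (u : ℕ) :
    P.run x (densify hs) (Nat.count (fun v => (s v).isSome) u) = P.sparseRun x s u := by
  induction u with
  | zero => rw [Nat.count_zero]; rfl
  | succ u ih =>
    by_cases hu : (s u).isSome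
    · have hstep : s u = some (densify hs (Nat.count (fun v => (s v).isSome) u)) := by
        rw [some_densify, Nat.nth_count (p := fun v => ((s v).isSome : Prop)) hu]
      rw [Nat.count_succ, if_pos hu, run, ih, P.sparseRun_succ_of_some x hstep]
    · rw [Nat.count_succ, if_neg hu, add_zero, ih,
        P.sparseRun_succ_of_none x (Option.not_isSome_iff_eq_none.mp hu)]

theorem run_densify (hs : {u | (s u).isSome}.Infinite) (m : ℕ) :
    P.run x (densify hs) m = P.sparseRun x s (Nat.nth (fun v => (s v).isSome) m) := by
  rw [← P.run_densify_count x hs, Nat.count_nth_of_infinite hs]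

end

/-! ### Agreeing on the states of a snapshot protocol -/

section

variable {n : ℕ} {A B : Type u} (P : SnapshotProtocol n A B)

/-- What the simulators agree upon for a simulated process: its local state together with the
contents of its components of the snapshot objects. -/
abbrev Image : Type u := P.State × (P.Obj → P.Val)

variable {P} in
/-- The image of the process `j` in a configuration. -/
def Config.image (C : P.Config) (j : Fin n) : P.Image :=
  (C.loc j, fun o => C.mem o j)

open scoped Classical in
/-- The effect of a step of process `j` on its image `w` when the snapshot objects have contents
`m`. -/
noncomputable def advance (j : Fin n) (w : P.Image) (m : P.Obj → Fin n → P.Val) : P.Image :=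
  match P.code j w.1 with
  | .decide _ => w
  | .update o v q => (q, Function.update w.2 o v)
  | .scan o f => (f (m o), w.2)

/-- The next step of process `j` is an update. -/
def IsUpdate (j : Fin n) (w : P.Image) : Prop :=
  ∃ o v q, P.code j w.1 = .update o v q

variable {P} in
theorem IsUpdate.advance_eq {j : Fin n} {w : P.Image} (h : P.IsUpdate j w)
    (m m' : P.Obj → Fin n → P.Val) : P.advance j w m = P.advance j w m' := by
  obtain ⟨o, v, q, h⟩ := h
  simp only [advance, h]

theorem advance_snd {j : Fin n} {w : P.Image} (h : ¬ P.IsUpdate j w)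
    (m : P.Obj → Fin n → P.Val) : (P.advance j w m).2 = w.2 := by
  unfold advance
  split
  · rfl
  · next hc => exact absurd ⟨_, _, _, hc⟩ h
  · rfl

theorem image_step_self (C : P.Config) (j : Fin n) :
    (P.step C j).image j = P.advance j (C.image j) C.mem := by
  classical
  cases hc : P.code j (C.loc j) with
  | decide b => simp only [step, advance, Config.image, hc]
  | scan o f => simp only [step, advance, Config.image, hc, Function.update_self]
  | update o v q =>
    simp only [step, advance, Config.image, hc, Function.update_self, Prod.mk.injEq, true_and]
    funext o'
    by_cases ho : o' = o
    · subst ho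
      simp only [Function.update_self]
    · simp only [Function.update_of_ne ho]

theorem image_step_of_ne (C : P.Config) {i j : Fin n} (h : j ≠ i) :
    (P.step C i).image j = C.image j := by
  classical
  cases hc : P.code i (C.loc i) with
  | decide b => simp only [step, hc]
  | scan o f => simp only [step, Config.image, hc, Function.update_of_ne h]
  | update o v q =>
    simp only [step, Config.image, hc, Function.update_of_ne h, Prod.mk.injEq, true_and]
    funext o'
    by_cases ho : o' = o
    · subst ho
      simp only [Function.update_self, Function.update_of_ne h]
    · simp only [Function.update_of_ne ho]

/-- `w` is the latest image of process `j` announced in `S`; images are announced in order. -/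
def LatestImage (S : Set (Msg n P.Image)) (j : Fin n) (w : P.Image) : Prop :=
  ∃ k, .dec (j, k) w ∈ S ∧ ∀ w', .dec (j, k + 1) w' ∉ S

open scoped Classical in
/-- The contents of the snapshot objects according to the images announced in `S`. -/
noncomputable def memOf (S : Set (Msg n P.Image)) (o : P.Obj) (j : Fin n) : P.Val :=
  if h : ∃ w, P.LatestImage S j w then h.choose.2 o else P.mem₀ o j

/-- In some image announced in `S`, the simulated process has decided `b`. -/
def DecidedIn (S : Set (Msg n P.Image)) (b : B) : Prop :=
  ∃ j k w, .dec (j, k) w ∈ S ∧ P.code j w.1 = .decide b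

open scoped Classical in
/-- The agreement protocol that simulates `P`. -/
noncomputable def simSpec : ChainSpec n A B P.Image where
  init j a := (P.start j a, fun o => P.mem₀ o j)
  next j w S := P.advance j w (P.memOf S)
  out S := if h : ∃ b, P.DecidedIn S b then some h.choose else none

theorem decidedIn_of_out {S : Set (Msg n P.Image)} {b : B} (h : P.simSpec.out S = some b) :
    P.DecidedIn S b := by
  by_cases hb : ∃ b, P.DecidedIn S b
  · rw [← Option.some.inj ((dif_pos hb).symm.trans h)]
    exact hb.choose_spec
  · cases (dif_neg hb).symm.trans h

theorem out_ne_none {S : Set (Msg n P.Image)} {b : B} (h : P.DecidedIn S b) :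
    P.simSpec.out S ≠ none :=
  fun ho => Option.some_ne_none _ ((dif_pos ⟨b, h⟩).symm.trans ho)

end

end SnapshotProtocol

/-! ### Linearizing the simulated steps -/

namespace Exec

variable {n m : ℕ} {A B : Type u} [NeZero n] {P : SnapshotProtocol n A B} {x : Fin m → A}
  {σ : ℕ → Fin m} {E : Exec P.simSpec x σ} {τ : ℕ} {j : Fin n} {k : ℕ} {w w' : P.Image}

theorem memOf_of_dec (h : .dec (j, k) w ∈ E.mem τ) (hn : ∀ v, .dec (j, k + 1) v ∉ E.mem τ)
    (o : P.Obj) : P.memOf (E.mem τ) o j = w.2 o := by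
  have hex : ∃ w, P.LatestImage (E.mem τ) j w := ⟨w, k, h, hn⟩
  obtain ⟨k', h', hn'⟩ := hex.choose_spec
  have hle {k k' : ℕ} {w w'} (h : .dec (j, k) w ∈ E.mem τ) (h' : .dec (j, k') w' ∈ E.mem τ)
      (hn : ∀ v, .dec (j, k + 1) v ∉ E.mem τ) : k' ≤ k :=
    not_lt.mp fun hlt => (dec_of_le hlt h').elim hn
  obtain rfl : k' = k := (hle h h' hn).antisymm (hle h' h hn')
  rw [SnapshotProtocol.memOf, dif_pos hex, dec_unique h' h]

theorem memOf_of_not_dec (hn : ∀ v, .dec (j, 0) v ∉ E.mem τ) (o : P.Obj) :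
    P.memOf (E.mem τ) o j = P.mem₀ o j := by
  refine dif_neg ?_
  rintro ⟨w, k, h, -⟩
  exact (dec_of_le k.zero_le h).elim hn

variable (E) in
/-- The step of the simulated process `j` from its image `w` of number `k` to its next image `w'`
takes effect at time `τ`. This is the time when `w'` is first announced if the step is an update,
and the time of the read on which `w'` is based otherwise. -/
structure TakesEffect (j : Fin n) (k : ℕ) (w w' : P.Image) (τ : ℕ) : Prop where
  dec : .dec (j, k) w ∈ E.mem τ
  not_dec : ∀ v, .dec (j, k + 1) v ∉ E.mem τ
  eq_advance : w' = P.advance j w (P.memOf (E.mem τ))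
  announce_or_read : P.IsUpdate j w ∧ (E.st τ (σ τ)).mode = .pend (.dec (j, k + 1) w') ∨
    ¬ P.IsUpdate j w ∧ (E.st τ (σ τ)).mode = .ready ∧ (E.st τ (σ τ)).cur = j

theorem exists_takesEffect (h : .dec (j, k + 1) w' ∈ E.mem τ) :
    ∃ w τ', E.TakesEffect j k w w' τ' := by
  obtain ⟨τ₁, -, hpend, hnot⟩ := exists_pend_of_mem h
  have hmem : .dec (j, k + 1) w' ∈ E.mem (τ₁ + 1) :=
    ((E.step τ₁).of_pend hpend).1 ▸ Set.mem_insert _ _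
  have hnot' (v) : .dec (j, k + 1) v ∉ E.mem τ₁ := fun hv => hnot (dec_unique hv h ▸ hv)
  generalize he : (j, k + 1) = e at hmem
  cases candidate_of_dec hmem with
  | init => cases he
  | @next τ' _ w hτ' hm hd =>
    cases he
    have hle : τ' ≤ τ₁ := Nat.lt_succ_iff.mp hτ'
    by_cases hup : P.IsUpdate (E.st τ' (σ τ')).cur w
    · exact ⟨w, τ₁, E.mem_mono hle hd, hnot', hup.advance_eq _ _, .inl ⟨hup, hpend⟩⟩
    · exact ⟨w, τ', hd, fun v hv => hnot' v (E.mem_mono hle hv), rfl, .inr ⟨hup, hm, rfl⟩⟩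

namespace TakesEffect

theorem process_unique {j' : Fin n} {k' : ℕ} {v v' : P.Image} (h : E.TakesEffect j k w w' τ)
    (h' : E.TakesEffect j' k' v v' τ) : j = j' := by
  rcases h.announce_or_read with ⟨-, hm⟩ | ⟨-, hm, hj⟩ <;>
    rcases h'.announce_or_read with ⟨-, hm'⟩ | ⟨-, hm', hj'⟩
  · cases hm.symm.trans hm'
    rfl
  · cases hm.symm.trans hm'
  · cases hm.symm.trans hm'
  · exact hj.symm.trans hj'

theorem dec_succ_of_isUpdate (h : E.TakesEffect j k w w' τ) (hup : P.IsUpdate j w) :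
    .dec (j, k + 1) w' ∈ E.mem (τ + 1) := by
  rcases h.announce_or_read with ⟨-, hm⟩ | ⟨hnot, -⟩
  · exact ((E.step τ).of_pend hm).1 ▸ Set.mem_insert _ _
  · exact absurd hup hnot

end TakesEffect

end Exec

/-- The data from which an execution of `P` is read off an execution `E` of its simulators: the
inputs of the simulated processes, their successive images, and the times when their steps take
effect. Where nothing is agreed upon in `E`, the values of `image` and `time` are arbitrary. -/
structure Linearization {n m : ℕ} {A B : Type u} [NeZero n] {P : SnapshotProtocol n A B}
    {x : Fin m → A} {σ : ℕ → Fin m} (E : Exec P.simSpec x σ) where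
  input : Fin n → A
  image : Fin n → ℕ → P.Image
  time : Fin n → ℕ → ℕ
  input_mem : ∀ j, input j ∈ Set.range x
  image_zero : ∀ j, image j 0 = P.simSpec.init j (input j)
  eq_image : ∀ {j k w τ}, .dec (j, k) w ∈ E.mem τ → w = image j k
  takesEffect : ∀ {j k}, E.Decided (j, k + 1) →
    E.TakesEffect j k (image j k) (image j (k + 1)) (time j k)

section

variable {n m : ℕ} {A B : Type u} [NeZero n] {P : SnapshotProtocol n A B} {x : Fin m → A}
  {σ : ℕ → Fin m}

theorem Exec.exists_input [NeZero m] (E : Exec P.simSpec x σ) (j : Fin n) :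
    ∃ a ∈ Set.range x, ∀ τ w, .dec (j, 0) w ∈ E.mem τ → w = P.simSpec.init j a := by
  by_cases h : ∃ τ w, .dec (j, 0) w ∈ E.mem τ
  · obtain ⟨τ, w, h⟩ := h
    generalize he : (j, 0) = e at h
    cases candidate_of_dec h with
    | init j p =>
      cases he
      exact ⟨x p, ⟨p, rfl⟩, fun τ' w' h' => dec_unique h' h⟩
    | next => cases he
  · push Not at h
    exact ⟨x 0, ⟨0, rfl⟩, fun τ w hw => absurd hw (h τ w)⟩

theorem Exec.nonempty_linearization [NeZero m] (E : Exec P.simSpec x σ) :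
    Nonempty (Linearization E) := by
  choose input input_mem hinput using E.exists_input
  have himage (j k) : ∃ v, (∀ τ w, .dec (j, k) w ∈ E.mem τ → w = v) ∧
      (k = 0 → v = P.simSpec.init j (input j)) := by
    cases k with
    | zero => exact ⟨_, hinput j, fun _ => rfl⟩
    | succ k =>
      by_cases h : ∃ τ w, .dec (j, k + 1) w ∈ E.mem τ
      · obtain ⟨τ, w, h⟩ := h
        exact ⟨w, fun τ' w' h' => dec_unique h' h, nofun⟩
      · push Not at h
        exact ⟨P.simSpec.init j (input j), fun τ w hw => absurd hw (h τ w), nofun⟩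
  choose image eq_image image_zero using himage
  have htime (j k) : ∃ τ, E.Decided (j, k + 1) →
      E.TakesEffect j k (image j k) (image j (k + 1)) τ := by
    by_cases h : E.Decided (j, k + 1)
    · obtain ⟨τ, w', h⟩ := h
      obtain ⟨w, τ', ht⟩ := exists_takesEffect h
      obtain rfl := eq_image _ _ _ _ h
      obtain rfl := eq_image _ _ _ _ ht.dec
      exact ⟨τ', fun _ => ht⟩
    · exact ⟨0, fun h' => absurd h' h⟩
  choose time takesEffect using htime
  exact ⟨⟨input, image, time, input_mem, fun j => image_zero j 0 rfl, eq_image _ _ _ _,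
    takesEffect _ _⟩⟩

end

namespace Linearization

variable {n m : ℕ} {A B : Type u} [NeZero n] {P : SnapshotProtocol n A B} {x : Fin m → A}
  {σ : ℕ → Fin m} {E : Exec P.simSpec x σ} (L : Linearization E) {j : Fin n} {k k' u τ : ℕ}

theorem time_lt_of_dec {w : P.Image} (h : .dec (j, k + 1) w ∈ E.mem τ) : L.time j k < τ :=
  not_le.mp fun hle => (L.takesEffect ⟨τ, w, h⟩).not_dec w (E.mem_mono hle h)

theorem time_lt_time (hlt : k < k') (h : E.Decided (j, k' + 1)) : L.time j k < L.time j k' :=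
  (Exec.dec_of_le hlt (L.takesEffect h).dec).elim fun _ => L.time_lt_of_dec

theorem decided_of_le (hle : k ≤ k') (h : E.Decided (j, k')) : E.Decided (j, k) :=
  let ⟨τ, _, hw⟩ := h
  ⟨τ, Exec.dec_of_le hle hw⟩

theorem le_time (h : E.Decided (j, k + 1)) : k ≤ L.time j k := by
  induction k with
  | zero => exact Nat.zero_le _
  | succ k ih =>
    exact (ih (decided_of_le (k + 1).le_succ h)).trans_lt (L.time_lt_time k.lt_succ_self h)

theorem exists_not_past (u : ℕ) (j : Fin n) :
    ∃ k, ¬ (E.Decided (j, k + 1) ∧ L.time j k < u) :=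
  ⟨u, fun h => (L.le_time h.1).not_gt h.2⟩

open scoped Classical in
/-- The number of steps of the process `j` that take effect before time `u`. -/
noncomputable def stage (u : ℕ) (j : Fin n) : ℕ :=
  Nat.find (L.exists_not_past u j)

theorem lt_stage_iff : k < L.stage u j ↔ E.Decided (j, k + 1) ∧ L.time j k < u := by
  classical
  rw [stage, Nat.lt_find_iff]
  refine ⟨fun h => not_not.mp (h k le_rfl), fun ⟨hd, ht⟩ k' hle => not_not.mpr ?_⟩
  refine ⟨decided_of_le (Nat.succ_le_succ hle) hd, ?_⟩
  rcases hle.eq_or_lt with rfl | hlt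
  exacts [ht, (L.time_lt_time hlt hd).trans ht]

theorem stage_zero (j : Fin n) : L.stage 0 j = 0 :=
  Nat.eq_zero_of_not_pos fun h => (L.lt_stage_iff.mp h).2.not_ge (Nat.zero_le _)

theorem stage_time (h : E.Decided (j, k + 1)) : L.stage (L.time j k) j = k := by
  refine eq_of_forall_lt_iff fun k' => L.lt_stage_iff.trans ⟨fun ⟨hd, ht⟩ => ?_, fun hlt => ?_⟩
  · exact not_le.mp fun hle => (hle.eq_or_lt.elim (fun h => h ▸ le_rfl)
      fun hlt => (L.time_lt_time hlt hd).le).not_gt ht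
  · exact ⟨decided_of_le (Nat.succ_le_succ hlt.le) h, L.time_lt_time hlt h⟩

theorem stage_time_succ (h : E.Decided (j, k + 1)) : L.stage (L.time j k + 1) j = k + 1 := by
  refine eq_of_forall_lt_iff fun k' => L.lt_stage_iff.trans ⟨fun ⟨hd, ht⟩ => ?_, fun hlt => ?_⟩
  · exact not_le.mp fun hle => (L.time_lt_time hle hd).not_ge (Nat.lt_succ_iff.mp ht)
  · refine ⟨decided_of_le hlt h, Nat.lt_succ_iff.mpr ?_⟩
    rcases (Nat.lt_succ_iff.mp hlt).eq_or_lt with rfl | hlt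
    exacts [le_rfl, (L.time_lt_time hlt h).le]

open scoped Classical in
/-- The schedule of the simulated processes: at every time the process whose step takes effect
moves. -/
noncomputable def sched (u : ℕ) : Option (Fin n) :=
  if h : ∃ j k, E.Decided (j, k + 1) ∧ L.time j k = u then some h.choose else none

theorem sched_eq_some_iff :
    L.sched u = some j ↔ ∃ k, E.Decided (j, k + 1) ∧ L.time j k = u := by
  by_cases hex : ∃ j k, E.Decided (j, k + 1) ∧ L.time j k = u
  · rw [sched, dif_pos hex, Option.some_inj]
    obtain ⟨k', hd', hk'⟩ := hex.choose_spec
    refine ⟨fun h => h ▸ ⟨k', hd', hk'⟩, fun ⟨k, hd, hk⟩ => ?_⟩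
    exact (hk' ▸ L.takesEffect hd').process_unique (hk ▸ L.takesEffect hd)
  · rw [sched, dif_neg hex]
    exact ⟨nofun, fun h => absurd ⟨j, h⟩ hex⟩

theorem stage_succ_of_sched (h : L.sched u = some j) :
    L.stage (u + 1) j = L.stage u j + 1 ∧
      L.image j (L.stage u j + 1) =
        P.advance j (L.image j (L.stage u j)) (P.memOf (E.mem u)) := by
  obtain ⟨k, hd, rfl⟩ := L.sched_eq_some_iff.mp h
  rw [L.stage_time hd, L.stage_time_succ hd]
  exact ⟨rfl, (L.takesEffect hd).eq_advance⟩

theorem stage_succ_of_sched_ne (h : L.sched u ≠ some j) : L.stage (u + 1) j = L.stage u j := by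
  refine eq_of_forall_lt_iff fun k => ?_
  rw [lt_stage_iff, lt_stage_iff]
  refine and_congr_right fun hd => ⟨fun hlt => ?_, fun hlt => hlt.trans u.lt_succ_self⟩
  exact (Nat.lt_succ_iff.mp hlt).lt_of_ne fun heq => h (L.sched_eq_some_iff.mpr ⟨k, hd, heq⟩)

theorem memOf_eq (u : ℕ) (o : P.Obj) (j : Fin n) :
    P.memOf (E.mem u) o j = (L.image j (L.stage u j)).2 o := by
  generalize hk : L.stage u j = k
  have hnext (v) : .dec (j, k + 1) v ∉ E.mem u := fun hv =>
    (L.lt_stage_iff.mpr ⟨⟨u, v, hv⟩, L.time_lt_of_dec hv⟩).ne hk.symm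
  by_cases hdec : ∃ w, .dec (j, k) w ∈ E.mem u
  · obtain ⟨w, hw⟩ := hdec
    rw [Exec.memOf_of_dec hw hnext, L.eq_image hw]
  push Not at hdec
  cases k with
  | zero => rw [Exec.memOf_of_not_dec hdec, L.image_zero]; rfl
  | succ k =>
    obtain ⟨hd, ht⟩ := L.lt_stage_iff.mp (k.lt_succ_self.trans_eq hk.symm)
    have heff := L.takesEffect hd
    have hscan : ¬ P.IsUpdate j (L.image j k) := fun hup =>
      hdec _ (E.mem_mono ht (heff.dec_succ_of_isUpdate hup))
    rw [Exec.memOf_of_dec (E.mem_mono ht.le heff.dec) hdec, heff.eq_advance, P.advance_snd hscan]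

theorem image_sparseRun (u : ℕ) (j : Fin n) :
    (P.sparseRun L.input L.sched u).image j = L.image j (L.stage u j) := by
  induction u generalizing j with
  | zero => rw [L.stage_zero, L.image_zero]; rfl
  | succ u ih =>
    have hmem : (P.sparseRun L.input L.sched u).mem = P.memOf (E.mem u) := by
      funext o i
      rw [L.memOf_eq, ← ih]
      rfl
    cases hs : L.sched u with
    | none => rw [P.sparseRun_succ_of_none _ hs, ih, L.stage_succ_of_sched_ne (hs ▸ nofun)]
    | some i =>
      rw [P.sparseRun_succ_of_some _ hs]
      by_cases hj : j = i
      · subst hj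
        obtain ⟨hstage, himage⟩ := L.stage_succ_of_sched hs
        rw [P.image_step_self, ih, hmem, hstage, himage]
      · rw [P.image_step_of_ne _ hj, ih,
          L.stage_succ_of_sched_ne fun h => hj (Option.some_injective _ (h.symm.trans hs))]

theorem exists_loc_eq_of_dec {w : P.Image} (h : .dec (j, k) w ∈ E.mem τ) :
    ∃ u ≤ τ, (P.sparseRun L.input L.sched u).loc j = w.1 := by
  obtain ⟨u, hu, hstage⟩ : ∃ u ≤ τ, L.stage u j = k := by
    cases k with
    | zero => exact ⟨0, τ.zero_le, L.stage_zero j⟩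
    | succ k => exact ⟨_, L.time_lt_of_dec h, L.stage_time_succ ⟨τ, w, h⟩⟩
  refine ⟨u, hu, congrArg Prod.fst ((L.image_sparseRun u j).trans ?_)⟩
  rw [hstage, L.eq_image h]

theorem infinite_sched (h : ∀ k, E.Decided (j, k)) : {u | L.sched u = some j}.Infinite :=
  Set.infinite_of_injective_forall_mem
    (strictMono_nat_of_lt_succ fun k => L.time_lt_time k.lt_succ_self (h _)).injective
    fun k => L.sched_eq_some_iff.mpr ⟨k, h _, rfl⟩

theorem exists_dec_loc (h : {u | L.sched u = some j}.Infinite) (u : ℕ) :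
    ∃ k τ w, .dec (j, k) w ∈ E.mem τ ∧ (P.sparseRun L.input L.sched u).loc j = w.1 := by
  have hdec : E.Decided (j, L.stage u j) := by
    cases hk : L.stage u j with
    | zero =>
      obtain ⟨v, hv⟩ := h.nonempty
      obtain ⟨k, hd, -⟩ := L.sched_eq_some_iff.mp hv
      exact decided_of_le (Nat.zero_le _) hd
    | succ k => exact (L.lt_stage_iff.mp (k.lt_succ_self.trans_eq hk.symm)).1
  obtain ⟨τ, w, hw⟩ := hdec
  exact ⟨_, τ, w, hw, congrArg Prod.fst ((L.image_sparseRun u j).trans (L.eq_image hw).symm)⟩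

end Linearization

/-! ### The simulation -/

theorem infinite_isSome {n : ℕ} {s : ℕ → Option (Fin n)} {j : Fin n}
    (h : {u | s u = some j}.Infinite) : {u | (s u).isSome}.Infinite :=
  h.mono fun _ => Option.isSome_of_mem

namespace Exec

variable {n m : ℕ} {A B : Type u} [NeZero n] {P : SnapshotProtocol n A B} {x : Fin m → A}
  {σ : ℕ → Fin m} {E : Exec P.simSpec x σ} {τ : ℕ}

theorem exists_done_of_decidedIn {p : Fin m} {b : B} (hp : ¬ Faulty σ p)
    (h : P.DecidedIn (E.mem τ) b) : ∃ τ' b, (E.st τ' p).mode = .done b := by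
  obtain ⟨j, k, w, hw, hcode⟩ := h
  exact exists_done hp fun τ' hle => P.out_ne_none ⟨j, k, w, E.mem_mono hle hw, hcode⟩

variable (E) in
/-- The execution of `P` with inputs `x'` and schedule `σ'` is simulated by `E`: it has at most as
many crashes, uses inputs of simulators only, decides what the simulators decide, and makes the
correct simulators decide as soon as one of its correct processes decides. -/
structure Simulates (x' : Fin n → A) (σ' : ℕ → Fin n) : Prop where
  ncard_faulty_le : {j | Faulty σ' j}.ncard ≤ {p | Faulty σ p}.ncard
  range_subset : Set.range x' ⊆ Set.range x
  decides : ∀ τ p b, (E.st τ p).mode = .done b → ∃ j, P.Decides x' σ' j b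
  exists_done : (∃ j, ¬ Faulty σ' j ∧ ∃ b, P.Decides x' σ' j b) →
    ∀ p, ¬ Faulty σ p → ∃ τ b, (E.st τ p).mode = .done b

end Exec

namespace Linearization

variable {n m : ℕ} {A B : Type u} [NeZero n] {P : SnapshotProtocol n A B} {x : Fin m → A}
  {σ : ℕ → Fin m} {E : Exec P.simSpec x σ} (L : Linearization E)

theorem decides_of_decidedIn {s : ℕ → Option (Fin n)} (hs : {u | (s u).isSome}.Infinite)
    {τ : ℕ} {b : B} (hagree : ∀ v < τ, s v = L.sched v) (h : P.DecidedIn (E.mem τ) b) :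
    ∃ j, P.Decides L.input (densify hs) j b := by
  obtain ⟨j, k, w, hw, hcode⟩ := h
  obtain ⟨u, hu, hloc⟩ := L.exists_loc_eq_of_dec hw
  refine ⟨j, Nat.count (fun v => (s v).isSome) u, ?_⟩
  rw [P.run_densify_count, P.sparseRun_congr L.input fun v hv => hagree v (hv.trans_le hu), hloc,
    hcode]

/-- The simulated processes may be blocked once a simulator has halted. As all decisions have been
made by a time `T`, the linearization is followed up to `T` only, and no process crashes. -/
theorem exists_simulates_of_done {τ : ℕ} {p : Fin m} {b : B} (h : (E.st τ p).mode = .done b) :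
    ∃ σ', E.Simulates L.input σ' := by
  obtain ⟨T, hT⟩ := E.exists_forall_done
  have hinf := infinite_thenRoundRobin (n := n) T L.sched
  have hs := infinite_isSome (hinf 0)
  refine ⟨densify hs, ?_, Set.range_subset_iff.mpr L.input_mem, fun τ p b hdone => ?_, ?_⟩
  · have hcorrect : {j | Faulty (densify hs) j} = ∅ :=
      Set.eq_empty_of_forall_notMem fun j hj => hinf j ((faulty_densify_iff hs).mp hj)
    rw [hcorrect, Set.ncard_empty]
    exact Nat.zero_le _
  · obtain ⟨τ', hτ', hout⟩ := Exec.exists_out_of_done (hT τ p b hdone)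
    exact L.decides_of_decidedIn hs (fun v hv => if_pos (hv.trans hτ')) (P.decidedIn_of_out hout)
  · intro _ q hq
    obtain ⟨τ', -, hout⟩ := Exec.exists_out_of_done h
    exact Exec.exists_done_of_decidedIn hq (P.decidedIn_of_out hout)

theorem exists_decidedIn_of_decides (hs : {u | (L.sched u).isSome}.Infinite) {j : Fin n} {b : B}
    (hj : ¬ Faulty (densify hs) j) (h : P.Decides L.input (densify hs) j b) :
    ∃ τ, P.DecidedIn (E.mem τ) b := by
  obtain ⟨a, hcode⟩ := h
  rw [P.run_densify] at hcode
  obtain ⟨k, τ, w, hw, hloc⟩ := L.exists_dec_loc (fun h => hj ((faulty_densify_iff hs).mpr h)) _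
  exact ⟨τ, j, k, w, hw, hloc ▸ hcode⟩

theorem exists_simulates_of_nonhalting [NeZero m] (hnh : E.Nonhalting)
    (hlt : {p | Faulty σ p}.ncard < n) : ∃ σ', E.Simulates L.input σ' := by
  have hle := Exec.ncard_not_decided_le hnh
  obtain ⟨j₀, hj₀⟩ : ∃ j, ∀ k, E.Decided (j, k) := by
    by_contra! hall
    have huniv : {j | ∃ k, ¬ E.Decided (j, k)} = Set.univ := Set.eq_univ_of_forall hall
    rw [huniv, Set.ncard_univ, Nat.card_fin] at hle
    exact hle.not_gt hlt
  have hs := infinite_isSome (L.infinite_sched hj₀)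
  refine ⟨densify hs, ?_, Set.range_subset_iff.mpr L.input_mem,
    fun τ p b hdone => absurd hdone (hnh τ p b), ?_⟩
  · refine (Set.ncard_le_ncard fun j hj => ?_).trans hle
    by_contra hdec
    exact L.infinite_sched (not_exists_not.mp hdec) ((faulty_densify_iff hs).mp hj)
  · rintro ⟨j, hj, b, hb⟩ p hp
    obtain ⟨τ, h⟩ := L.exists_decidedIn_of_decides hs hj hb
    exact Exec.exists_done_of_decidedIn hp h

end Linearization

theorem Exec.exists_simulates {n m : ℕ} {A B : Type u} [NeZero n] [NeZero m]
    {P : SnapshotProtocol n A B} {x : Fin m → A} {σ : ℕ → Fin m} (E : Exec P.simSpec x σ)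
    (hlt : {p | Faulty σ p}.ncard < n) : ∃ x' σ', E.Simulates x' σ' := by
  obtain ⟨L⟩ := E.nonempty_linearization
  by_cases hnh : E.Nonhalting
  · exact ⟨_, L.exists_simulates_of_nonhalting hnh hlt⟩
  · simp only [Exec.Nonhalting, not_forall, not_not] at hnh
    obtain ⟨τ, p, b, hdone⟩ := hnh
    exact ⟨_, L.exists_simulates_of_done hdone⟩

theorem ncard_faulty_lt {n : ℕ} [NeZero n] (σ : ℕ → Fin n) : {p | Faulty σ p}.ncard < n := by
  obtain ⟨p, hp⟩ := exists_not_faulty σ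
  refine (Set.ncard_lt_card fun h => hp ?_).trans_eq (Nat.card_fin n)
  exact h.ge (Set.mem_univ p)

theorem SnapshotProtocol.simulates_simSpec {n t : ℕ} {A B : Type u} [NeZero n]
    (P : SnapshotProtocol n A B) : P.simSpec.protocol.Simulates t P := by
  intro x σ hσ
  obtain ⟨x', σ', h⟩ := (P.simSpec.exec x σ).exists_simulates (ncard_faulty_lt σ)
  simp only [ChainSpec.decides_protocol_iff]
  exact ⟨x', σ', h.ncard_faulty_le.trans hσ, h.range_subset,
    fun p b ⟨τ, hdone⟩ => h.decides τ p b hdone,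
    fun hdec p hp => exists_comm.mp (h.exists_done hdec p hp)⟩

theorem WeakSetProtocol.Simulates.solves {n t : ℕ} {A B : Type u} [NeZero n]
    {P : SnapshotProtocol n A B} {Q : WeakSetProtocol A B} (hQ : Q.Simulates t P)
    {T : ColorlessTask A B} (hP : P.Solves t T) : Q.Solves n t T := by
  classical
  intro s hs x hx σ hσ
  obtain ⟨x', σ', hσ', hx', hdec, hlive⟩ := hQ x σ hσ
  have hx's (i) : x' i ∈ s := by
    obtain ⟨j, hj⟩ := hx' ⟨i, rfl⟩
    exact hj ▸ hx j
  obtain ⟨hterm, s', hs', hval⟩ := hP s hs x' hx's σ' hσ'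
  have hmem {i b} (h : Q.Decides x σ i b) : b ∈ s' :=
    Finset.mem_coe.mp (hval ▸ hdec i b h)
  obtain ⟨j, hj⟩ := exists_not_faulty σ'
  have hall := hlive ⟨j, hj, hterm j hj⟩
  obtain ⟨i, hi⟩ := exists_not_faulty σ
  obtain ⟨b, hb⟩ := hall i hi
  refine ⟨hall, s'.filter fun b => ∃ i, Q.Decides x σ i b, ?_, ?_⟩
  · exact (T.carrier s).isRelLowerSet_faces.mem_of_le hs' (Finset.filter_subset _ s')
      ⟨b, Finset.mem_filter.mpr ⟨hmem hb, i, hb⟩⟩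
  · ext b
    simp only [Finset.coe_filter, Set.mem_ofPred_eq]
    exact ⟨And.right, fun ⟨i, hi⟩ => ⟨hmem hi, i, hi⟩⟩

end Resilient

theorem mainTheorem2 {A B : Type u} (n t : ℕ) (htn : t < n) :
    (∀ P : Resilient.SnapshotProtocol n A B,
        ∃ Q : Resilient.WeakSetProtocol A B, Q.Simulates t P) ∧
      (∀ T : Resilient.ColorlessTask A B,
        Resilient.SolvableNonAnonymously n t T → Resilient.SolvableAnonymously n t T) := by
  have : NeZero n := ⟨htn.ne_bot⟩
  have hsim (P : Resilient.SnapshotProtocol n A B) :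
      ∃ Q : Resilient.WeakSetProtocol A B, Q.Simulates t P :=
    ⟨_, P.simulates_simSpec⟩
  refine ⟨hsim, ?_⟩
  rintro T ⟨P, hP⟩
  obtain ⟨Q, hQ⟩ := hsim P
  exact ⟨Q, hQ.solves hP⟩
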